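/- **Setting.** Let $\mathcal C$ be a concrete monoidal $W^*$-category: a monoidal $W^*$-category with a normal strong monoidal $*$-functor (unitary coherence isomorphisms) to the category of Hilbert spaces with the completed tensor product; the Hilbert spaces underlying $H,K,L$ are written $\mathscr H,\mathscr K,\mathscr L$, and $\mathbb K(\mathscr H,\mathscr K)$, $B(\mathscr H,\mathscr K)_*$ denote the compact operators and the normal functionals on the bounded operators. For a set $X$ of operators let $[X]$ be its closed linear span. Let $c$ be a unitary braiding on $\mathcal C$ which is *regular*: $[(\mathrm{id}\otimes\omega)(c_{H,K})\mid\omega\in B(\mathscr K,\mathscr H)_*]=\mathbb K(\mathscr H,\mathscr K)$ for all $H,K\in\mathcal C$. For $T\in\mathrm{End}_{\mathcal C}(X\otimes Z)$ put $T_{13}:=(c_{X,Y})_{12}^{-1}\,T_{23}\,(c_{X,Y})_{12}$ and $T_{13}':=(c_{Y,X})_{12}\,T_{23}\,(c_{Y,X})_{12}^{-1}$ in $\mathrm{End}_{\mathcal C}(X\otimes Y\otimes Z)$. A *multiplicative unitary* in $\mathcal C$ is a unitary $W\in\mathrm{End}_{\mathcal C}(K\otimes K)$ with $W_{23}W_{12}=W_{12}W_{13}W_{23}$.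 A unitary $W\in \mathrm{End}_{\mathcal C}(K\otimes K)$ is *regular* if $[(\mathrm{id}\otimes\omega)(c_{K,K}^{-1}W)\mid\omega\in B(\mathscr K)_*]=\mathbb K(\mathscr K)$. A *fixed vector* for $W$ is a morphism $e:\mathbb 1\to K$ with $W(e\otimes\xi)=e\otimes\xi$ for all $\xi\in\mathscr K$; it is non-zero if the corresponding vector of $\mathscr K$ is non-zero. Let $W\in \mathrm{End}_{\mathcal C}(K\otimes K)$ be a regular multiplicative unitary. A *Yetter–Drinfeld module* of $W$ is a triple $(X,U,V)$ with $U\in\mathrm{End}_{\mathcal C}(X\otimes K)$, $V\in\mathrm{End}_{\mathcal C}(K\otimes X)$ unitary such that $W_{23}U_{12}=U_{12}U_{13}W_{23}$, $V_{23}W_{12}=W_{12}V_{13}V_{23}$ and $V_{12}W_{13}U_{23}=U_{23}W_{13}'V_{12}$. The tensor product of $(X_1,U_1,V_1)$ and $(X_2,U_2,V_2)$ is $(X_1\otimes X_2,\ (U_1)_{13}(U_2)_{23},\ (V_2)_{13}'(V_1)_{12})$, and morphisms are the morphisms of $\mathcal C$ that intertwine the $U$'s and the $V$'s. For $U\in \mathrm{End}_{\mathcal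 C}(H\otimes K)$ and $V\in\mathrm{End}_{\mathcal C}(K\otimes X)$ as above, $V*U$ is the unitary on $\mathscr H\otimes\mathscr X$ with $(c_{X,K})_{23}\,(V*U)_{12}\,(c_{X,K})_{23}^{-1}=U_{12}^*V_{23}U_{12}V_{23}^*$ on $H\otimes K\otimes X$, and the braiding of the Yetter–Drinfeld category is $\Phi_{A,B}:=(V_A*U_B)^*\circ c_{A,B}:A\otimes B\to B\otimes A$. Let $L=(\check L,U,V)$ be a Yetter–Drinfeld module of $W$ and let $F\in\mathrm{End}_{\mathcal C}(\check L\otimes\check L)$ be a multiplicative unitary in the Yetter–Drinfeld category, i.e. a unitary morphism $L\otimes L\to L\otimes L$ of Yetter–Drinfeld modules with $F_{23}F_{12}=F_{12}\,(\Phi_{L,L}^{-1})_{12}\,F_{23}\,(\Phi_{L,L})_{12}\,F_{23}$. It is *regular* if $[(\mathrm{id}\otimes\omega)(\Phi_{L,L}^{-1}F)\mid\omega\in B(\check{\mathscr L})_*]=\mathbb K(\check{\mathscr L})$. The *semi-direct product* is $$W\ltimes F:=W_{13}\,U_{23}\,V_{34}^*\,F_{24}\,V_{34}\in\mathrm{End}_{\mathcal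 C}(K\otimes\check L\otimes K\otimes\check L),$$ where $W_{13}$ and $F_{24}$ are formed like $T_{13}$ above; its regularity is understood with respect to the object $K\otimes\check L$ of $\mathcal C$. **Proposition.** 1. If $F$ is regular, then $W\ltimes F$ is regular. 2. If $W$ admits a non-zero fixed vector and $W\ltimes F$ is regular, then $F$ is regular. -/

import Mathlib

open CategoryTheory MonoidalCategory
open scoped TensorProduct InnerProductSpace Topology

universe v u w

namespace BraidedMU

noncomputable section

/-! ### `C*`-categories and `W*`-categories -/

/-- A `C*`-category: the morphism spaces are complex Banach spaces, composition is contractive and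
bilinear, and there is an isometric, conjugate-linear, contravariant involution `adj` satisfying
the `C*`-identity. Composition is written in diagrammatic order, `f ≫ g = g ∘ f`. -/
class CStarCategory (C : Type u) [Category.{v} C] [Preadditive C] [Linear ℂ C] where
  [homNorm (X Y : C) : Norm (X ⟶ Y)]
  normCore (X Y : C) : NormedSpace.Core ℂ (X ⟶ Y)
  complete {X Y : C} (s : ℕ → (X ⟶ Y))
    (hs : ∀ ε : ℝ, 0 < ε → ∃ N, ∀ m ≥ N, ∀ n ≥ N, ‖s m - s n‖ < ε) :
    ∃ f : X ⟶ Y, ∀ ε : ℝ, 0 < ε → ∃ N, ∀ n ≥ N, ‖s n - f‖ < ε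
  norm_comp_le {X Y Z : C} (f : X ⟶ Y) (g : Y ⟶ Z) : ‖f ≫ g‖ ≤ ‖f‖ * ‖g‖
  adj {X Y : C} : (X ⟶ Y) → (Y ⟶ X)
  adj_add {X Y : C} (f g : X ⟶ Y) : adj (f + g) = adj f + adj g
  adj_smul {X Y : C} (a : ℂ) (f : X ⟶ Y) : adj (a • f) = star a • adj f
  adj_adj {X Y : C} (f : X ⟶ Y) : adj (adj f) = f
  adj_comp {X Y Z : C} (f : X ⟶ Y) (g : Y ⟶ Z) : adj (f ≫ g) = adj g ≫ adj f
  norm_adj {X Y : C} (f : X ⟶ Y) : ‖adj f‖ = ‖f‖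
  norm_comp_adj {X Y : C} (f : X ⟶ Y) : ‖f ≫ adj f‖ = ‖f‖ ^ 2

attribute [reducible] CStarCategory.homNorm

attribute [instance] CStarCategory.homNorm

/-- A `W*`-category: a `C*`-category in which every morphism space is (isometrically) the dual of
a Banach space. -/
class WStarCategory (C : Type u) [Category.{v} C] [Preadditive C] [Linear ℂ C]
    extends CStarCategory C where
  Predual : C → C → Type v
  [predualGroup (X Y : C) : NormedAddCommGroup (Predual X Y)]
  [predualSpace (X Y : C) : NormedSpace ℂ (Predual X Y)]
  [predualComplete (X Y : C) : CompleteSpace (Predual X Y)]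
  pairing (X Y : C) : (X ⟶ Y) ≃ₗ[ℂ] StrongDual ℂ (Predual X Y)
  norm_pairing {X Y : C} (f : X ⟶ Y) : ‖pairing X Y f‖ = ‖f‖

attribute [reducible] WStarCategory.predualGroup WStarCategory.predualSpace

attribute [instance] WStarCategory.predualGroup WStarCategory.predualSpace
  WStarCategory.predualComplete

/-- The ultraweak topology on a morphism space of a `W*`-category. -/
@[reducible] def ultraweak {C : Type u} [Category.{v} C] [Preadditive C] [Linear ℂ C] [WStarCategory C]
    (X Y : C) : TopologicalSpace (X ⟶ Y) :=
  TopologicalSpace.induced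
    (fun (f : X ⟶ Y) (p : WStarCategory.Predual X Y) => WStarCategory.pairing X Y f p)
    Pi.topologicalSpace

/-- Unitary morphisms. -/
def IsUnitary {C : Type u} [Category.{v} C] [Preadditive C] [Linear ℂ C] [CStarCategory C]
    {X Y : C} (f : X ⟶ Y) : Prop :=
  f ≫ CStarCategory.adj f = 𝟙 X ∧ CStarCategory.adj f ≫ f = 𝟙 Y

/-- A monoidal `W*`-category: the tensor product is a bilinear, `*`-preserving bifunctor that is
ultraweakly continuous in each variable. -/
class MonoidalWStarCategory (C : Type u) [Category.{v} C] [Preadditive C] [Linear ℂ C]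
    [MonoidalCategory C] [MonoidalPreadditive C] [MonoidalLinear ℂ C]
    extends WStarCategory C where
  adj_whiskerLeft (X : C) {Y Z : C} (f : Y ⟶ Z) : adj (X ◁ f) = X ◁ adj f
  adj_whiskerRight {Y Z : C} (f : Y ⟶ Z) (X : C) : adj (f ▷ X) = adj f ▷ X
  normal_whiskerLeft (X Y Z : C) :
    Continuous[ultraweak Y Z, ultraweak (X ⊗ Y) (X ⊗ Z)] (fun f : Y ⟶ Z => X ◁ f)
  normal_whiskerRight (X Y Z : C) :
    Continuous[ultraweak Y Z, ultraweak (Y ⊗ X) (Z ⊗ X)] (fun f : Y ⟶ Z => f ▷ X)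

/-! ### Normal functionals on `B(H, H')` -/

/-- A normal functional on `B(H, H')`, i.e. an element of the predual `B(H, H')_*`, presented by
square-summable sequences `ξ` in `H` and `η` in `H'`; it maps `T` to `∑ n, ⟪η n, T (ξ n)⟫`. -/
structure NormalFunctional (H H' : Type*) [NormedAddCommGroup H] [InnerProductSpace ℂ H]
    [NormedAddCommGroup H'] [InnerProductSpace ℂ H'] where
  ξ : ℕ → H
  η : ℕ → H'
  summable_ξ : Summable fun n => ‖ξ n‖ ^ 2
  summable_η : Summable fun n => ‖η n‖ ^ 2

/-- The value of a normal functional at a bounded operator. -/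
def NormalFunctional.apply {H H' : Type*} [NormedAddCommGroup H] [InnerProductSpace ℂ H]
    [NormedAddCommGroup H'] [InnerProductSpace ℂ H'] (ω : NormalFunctional H H')
    (T : H →L[ℂ] H') : ℂ :=
  ∑' n, ⟪ω.η n, T (ω.ξ n)⟫_ℂ

/-- The ultraweak topology on `B(H, H')`. -/
@[reducible] def opUltraweak (H H' : Type*) [NormedAddCommGroup H] [InnerProductSpace ℂ H]
    [NormedAddCommGroup H'] [InnerProductSpace ℂ H'] : TopologicalSpace (H →L[ℂ] H') :=
  TopologicalSpace.induced
    (fun (T : H →L[ℂ] H') (ω : NormalFunctional H H') => ω.apply T) Pi.topologicalSpace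

/-! ### Concrete monoidal `W*`-categories -/

/-- A normal strong monoidal `*`-functor from `C` to the category of Hilbert spaces and bounded
operators with the completed tensor product. The unitary coherence isomorphism
`obj X ⊗̂ obj Y ≅ obj (X ⊗ Y)` is given by its restriction `μ X Y` to the algebraic tensor product,
a linear isometry with dense range. -/
structure FibreFunctor (C : Type u) [Category.{v} C] [Preadditive C] [Linear ℂ C]
    [MonoidalCategory C] [MonoidalPreadditive C] [MonoidalLinear ℂ C]
    [MonoidalWStarCategory C] where
  obj : C → Type w
  [objGroup (X : C) : NormedAddCommGroup (obj X)]
  [objInner (X : C) : InnerProductSpace ℂ (obj X)]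
  [objComplete (X : C) : CompleteSpace (obj X)]
  map {X Y : C} : (X ⟶ Y) → (obj X →L[ℂ] obj Y)
  map_id (X : C) : map (𝟙 X) = ContinuousLinearMap.id ℂ (obj X)
  map_comp {X Y Z : C} (f : X ⟶ Y) (g : Y ⟶ Z) : map (f ≫ g) = map g ∘L map f
  map_add {X Y : C} (f g : X ⟶ Y) : map (f + g) = map f + map g
  map_smul {X Y : C} (a : ℂ) (f : X ⟶ Y) : map (a • f) = a • map f
  map_adj {X Y : C} (f : X ⟶ Y) :
    map (CStarCategory.adj f) = ContinuousLinearMap.adjoint (map f)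
  normal (X Y : C) : Continuous[ultraweak X Y, opUltraweak (obj X) (obj Y)]
    (map : (X ⟶ Y) → (obj X →L[ℂ] obj Y))
  μ (X Y : C) : (obj X ⊗[ℂ] obj Y) →ₗᵢ[ℂ] obj (X ⊗ Y)
  μ_dense (X Y : C) : DenseRange (μ X Y)
  ε : ℂ ≃ₗᵢ[ℂ] obj (𝟙_ C)
  μ_natural_left {X X' : C} (f : X ⟶ X') (Y : C) (x : obj X) (y : obj Y) :
    map (f ▷ Y) (μ X Y (x ⊗ₜ[ℂ] y)) = μ X' Y (map f x ⊗ₜ[ℂ] y)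
  μ_natural_right (X : C) {Y Y' : C} (g : Y ⟶ Y') (x : obj X) (y : obj Y) :
    map (X ◁ g) (μ X Y (x ⊗ₜ[ℂ] y)) = μ X Y' (x ⊗ₜ[ℂ] map g y)
  μ_assoc (X Y Z : C) (x : obj X) (y : obj Y) (z : obj Z) :
    map (α_ X Y Z).hom (μ (X ⊗ Y) Z (μ X Y (x ⊗ₜ[ℂ] y) ⊗ₜ[ℂ] z)) =
      μ X (Y ⊗ Z) (x ⊗ₜ[ℂ] μ Y Z (y ⊗ₜ[ℂ] z))
  μ_leftUnit (X : C) (x : obj X) : map (λ_ X).hom (μ (𝟙_ C) X (ε 1 ⊗ₜ[ℂ] x)) = x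
  μ_rightUnit (X : C) (x : obj X) : map (ρ_ X).hom (μ X (𝟙_ C) (x ⊗ₜ[ℂ] ε 1)) = x

attribute [instance] FibreFunctor.objGroup FibreFunctor.objInner FibreFunctor.objComplete

section

variable {C : Type u} [Category.{v} C] [Preadditive C] [Linear ℂ C] [MonoidalCategory C]
  [MonoidalPreadditive C] [MonoidalLinear ℂ C] [MonoidalWStarCategory C]

namespace FibreFunctor

variable (Fib : FibreFunctor.{v, u, w} C)

/-- The operator `x ↦ x ⊗ y` from `obj X` to `obj (X ⊗ Y)`. -/
def ket (X : C) {Y : C} (y : Fib.obj Y) : Fib.obj X →L[ℂ] Fib.obj (X ⊗ Y) :=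
  (Fib.μ X Y).toContinuousLinearMap ∘L
    (TensorProduct.mkL ℂ (Fib.obj X) (Fib.obj Y)).flip y

/-- The slice `(id ⊗ ω)(T)`; for `ω = ∑ n, ⟪η n, · (ξ n)⟫` this is the (absolutely convergent)
sum of the operators `(id ⊗ ⟨η n|) T (id ⊗ |ξ n⟩)`. -/
def slice {X Y X' Y' : C} (T : Fib.obj (X ⊗ Y) →L[ℂ] Fib.obj (X' ⊗ Y'))
    (ω : NormalFunctional (Fib.obj Y) (Fib.obj Y')) : Fib.obj X →L[ℂ] Fib.obj X' :=
  ∑' n, ContinuousLinearMap.adjoint (Fib.ket X' (ω.η n)) ∘L T ∘L Fib.ket X (ω.ξ n)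

/-- The norm-closed linear span of all slices `(id ⊗ ω)(T)`, `ω` a normal functional. -/
def slices {X Y X' Y' : C} (T : Fib.obj (X ⊗ Y) →L[ℂ] Fib.obj (X' ⊗ Y')) :
    Submodule ℂ (Fib.obj X →L[ℂ] Fib.obj X') :=
  (Submodule.span ℂ (Set.range (Fib.slice T))).topologicalClosure

/-- The compact operators from `obj X` to `obj Y`. -/
def compacts (X Y : C) : Submodule ℂ (Fib.obj X →L[ℂ] Fib.obj Y) :=
  compactOperator (RingHom.id ℂ) (Fib.obj X) (Fib.obj Y)

/-- The operator `T ⊗ id` from `obj (A ⊗ Z)` to `obj (B ⊗ Z)`, for a bounded operator `T` from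
`obj A` to `obj B` that need not come from a morphism of `C`. -/
def amp {A B : C} (T : Fib.obj A →L[ℂ] Fib.obj B) (Z : C) :
    Fib.obj (A ⊗ Z) →L[ℂ] Fib.obj (B ⊗ Z) :=
  ((Fib.μ B Z).toContinuousLinearMap ∘L T.rTensor (Fib.obj Z)).extend
    (Fib.μ A Z).toContinuousLinearMap

theorem amp_tmul {A B : C} (T : Fib.obj A →L[ℂ] Fib.obj B) (Z : C) (a : Fib.obj A)
    (z : Fib.obj Z) : Fib.amp T Z (Fib.μ A Z (a ⊗ₜ[ℂ] z)) = Fib.μ B Z (T a ⊗ₜ[ℂ] z) := by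
  have h := ContinuousLinearMap.extend_eq
    ((Fib.μ B Z).toContinuousLinearMap ∘L T.rTensor (Fib.obj Z))
    (e := (Fib.μ A Z).toContinuousLinearMap) (Fib.μ_dense A Z)
    (Fib.μ A Z).isometry.isUniformInducing (a ⊗ₜ[ℂ] z)
  simpa [amp] using h

end FibreFunctor

variable [BraidedCategory C]

/-- The braiding `c` of `C` is regular: it is unitary, and for all objects `H`, `K` the closed
linear span of the slices `(id ⊗ ω)(c_{H,K})`, `ω ∈ B(K, H)_*`, equals the compact operators from
`H` to `K`. -/
def IsRegularBraiding (Fib : FibreFunctor.{v, u, w} C) : Prop :=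
  (∀ H K : C, IsUnitary (β_ H K).hom) ∧
    ∀ H K : C, Fib.slices (Fib.map (β_ H K).hom) = Fib.compacts H K

/-! ### Leg notation -/

/-- `T₂₃` on `(X ⊗ Y) ⊗ Z`. -/
def leg23 (X : C) {Y Z : C} (T : Y ⊗ Z ⟶ Y ⊗ Z) : (X ⊗ Y) ⊗ Z ⟶ (X ⊗ Y) ⊗ Z :=
  (α_ X Y Z).hom ≫ X ◁ T ≫ (α_ X Y Z).inv

/-- `b₁₂⁻¹ T₂₃ b₁₂` on `(X ⊗ Y) ⊗ Z`, for an isomorphism `b : X ⊗ Y ≅ Y ⊗ X`. -/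
def leg13 {X Y Z : C} (b : X ⊗ Y ≅ Y ⊗ X) (T : X ⊗ Z ⟶ X ⊗ Z) :
    (X ⊗ Y) ⊗ Z ⟶ (X ⊗ Y) ⊗ Z :=
  b.hom ▷ Z ≫ leg23 Y T ≫ b.inv ▷ Z

/-- `T` on the first and third leg, passing in front of the middle leg:
`(c_{X,Y})₁₂⁻¹ T₂₃ (c_{X,Y})₁₂`. -/
def leg13Over {X Z : C} (Y : C) (T : X ⊗ Z ⟶ X ⊗ Z) : (X ⊗ Y) ⊗ Z ⟶ (X ⊗ Y) ⊗ Z :=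
  leg13 (β_ X Y) T

/-- `T` on the first and third leg, passing behind the middle leg:
`(c_{Y,X})₁₂ T₂₃ (c_{Y,X})₁₂⁻¹`. -/
def leg13Under {X Z : C} (Y : C) (T : X ⊗ Z ⟶ X ⊗ Z) : (X ⊗ Y) ⊗ Z ⟶ (X ⊗ Y) ⊗ Z :=
  leg13 (β_ Y X).symm T

/-! ### Multiplicative unitaries in `C` -/

/-- Multiplicative unitaries: unitary solutions of the braided pentagon equation
`W₂₃ W₁₂ = W₁₂ (c⁻¹)₁₂ W₂₃ c₁₂ W₂₃`. -/
structure IsMultiplicativeUnitary {K : C} (W : K ⊗ K ⟶ K ⊗ K) : Prop where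
  unitary : IsUnitary W
  pentagon : W ▷ K ≫ leg23 K W = leg23 K W ≫ leg13Over K W ≫ W ▷ K

/-- Regularity: the closed linear span of the slices `(id ⊗ ω)(c_{K,K}⁻¹ ∘ W)`, `ω ∈ B(K)_*`, is
the space of compact operators. -/
def IsRegular (Fib : FibreFunctor.{v, u, w} C) {K : C} (W : K ⊗ K ⟶ K ⊗ K) : Prop :=
  Fib.slices (Fib.map (W ≫ (β_ K K).inv)) = Fib.compacts K K

/-- The vector of `obj K` given by a morphism `𝟙 ⟶ K`. -/
def vec (Fib : FibreFunctor.{v, u, w} C) {K : C} (e : 𝟙_ C ⟶ K) : Fib.obj K :=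
  Fib.map e (Fib.ε 1)

/-- Fixed vectors: morphisms `e : 𝟙 ⟶ K` with `W (e ⊗ ξ) = e ⊗ ξ` for all vectors `ξ`. -/
def IsFixedVector (Fib : FibreFunctor.{v, u, w} C) {K : C} (W : K ⊗ K ⟶ K ⊗ K)
    (e : 𝟙_ C ⟶ K) : Prop :=
  ∀ ξ : Fib.obj K,
    Fib.map W (Fib.μ K K (vec Fib e ⊗ₜ[ℂ] ξ)) = Fib.μ K K (vec Fib e ⊗ₜ[ℂ] ξ)

/-! ### Yetter-Drinfeld modules -/

/-- Objects of the Yetter-Drinfeld category of `W`. -/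
structure YetterDrinfeld {K : C} (W : K ⊗ K ⟶ K ⊗ K) where
  X : C
  U : X ⊗ K ⟶ X ⊗ K
  V : K ⊗ X ⟶ K ⊗ X
  unitary_U : IsUnitary U
  unitary_V : IsUnitary V
  corep : U ▷ K ≫ leg23 X W = leg23 X W ≫ leg13Over K U ≫ U ▷ K
  rep : W ▷ X ≫ leg23 K V = leg23 K V ≫ leg13Over K V ≫ W ▷ X
  compat : leg23 K U ≫ leg13Over X W ≫ V ▷ K = V ▷ K ≫ leg13Under X W ≫ leg23 K U

namespace YetterDrinfeld

variable {K : C} {W : K ⊗ K ⟶ K ⊗ K}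

/-- The corepresentation on the tensor product of two Yetter-Drinfeld modules. -/
def tensorU (A B : YetterDrinfeld W) : (A.X ⊗ B.X) ⊗ K ⟶ (A.X ⊗ B.X) ⊗ K :=
  leg23 A.X B.U ≫ leg13Over B.X A.U

/-- The representation on the tensor product of two Yetter-Drinfeld modules. -/
def tensorV (A B : YetterDrinfeld W) : K ⊗ (A.X ⊗ B.X) ⟶ K ⊗ (A.X ⊗ B.X) :=
  (α_ K A.X B.X).inv ≫ (A.V ▷ B.X ≫ leg13Under A.X B.V) ≫ (α_ K A.X B.X).hom

/-- `f` is a morphism of Yetter-Drinfeld modules from `A₁ ⊗ A₂` to `B₁ ⊗ B₂`. -/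
def IsTensorHom (A₁ A₂ B₁ B₂ : YetterDrinfeld W) (f : A₁.X ⊗ A₂.X ⟶ B₁.X ⊗ B₂.X) : Prop :=
  tensorU A₁ A₂ ≫ f ▷ K = f ▷ K ≫ tensorU B₁ B₂ ∧
    tensorV A₁ A₂ ≫ K ◁ f = K ◁ f ≫ tensorV B₁ B₂

end YetterDrinfeld

/-- `U₁₂* V₂₃ U₁₂ V₂₃*` on `H ⊗ K ⊗ X`, for `U` on `H ⊗ K` and `V` on `K ⊗ X`. -/
def starTriple {H K X : C} (U : H ⊗ K ⟶ H ⊗ K) (V : K ⊗ X ⟶ K ⊗ X) :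
    (H ⊗ K) ⊗ X ⟶ (H ⊗ K) ⊗ X :=
  leg23 H (CStarCategory.adj V) ≫ U ▷ X ≫ leg23 H V ≫ CStarCategory.adj U ▷ X

/-- `starTriple U V`, conjugated by the crossing of `X` in front of `K`. -/
def starTriple' {H K X : C} (U : H ⊗ K ⟶ H ⊗ K) (V : K ⊗ X ⟶ K ⊗ X) :
    (H ⊗ X) ⊗ K ⟶ (H ⊗ X) ⊗ K :=
  ((α_ H X K).hom ≫ H ◁ (β_ X K).hom ≫ (α_ H K X).inv) ≫ starTriple U V ≫
    ((α_ H K X).hom ≫ H ◁ (β_ X K).inv ≫ (α_ H X K).inv)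

/-- `Z` is the product `V ∗ U`: it is unitary and, put on the outer legs of `H ⊗ K ⊗ X` so as to
pass in front of the middle leg, it equals `U₁₂* V₂₃ U₁₂ V₂₃*`. -/
def IsStarProduct (Fib : FibreFunctor.{v, u, w} C) {H K X : C} (U : H ⊗ K ⟶ H ⊗ K)
    (V : K ⊗ X ⟶ K ⊗ X) (Z : Fib.obj (H ⊗ X) →L[ℂ] Fib.obj (H ⊗ X)) : Prop :=
  Z ∈ unitary (Fib.obj (H ⊗ X) →L[ℂ] Fib.obj (H ⊗ X)) ∧
    Fib.amp Z K = Fib.map (starTriple' U V)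

open Classical in
/-- The product `V ∗ U`. For a good multiplicative unitary on a non-zero object it exists and is
unique. -/
def starProduct (Fib : FibreFunctor.{v, u, w} C) {H K X : C} (U : H ⊗ K ⟶ H ⊗ K)
    (V : K ⊗ X ⟶ K ⊗ X) : Fib.obj (H ⊗ X) →L[ℂ] Fib.obj (H ⊗ X) :=
  if h : ∃ Z, IsStarProduct Fib U V Z then h.choose else 1

namespace YetterDrinfeld

variable {K : C} {W : K ⊗ K ⟶ K ⊗ K}

/-- The braiding `Φ_{A,B} = (V_A ∗ U_B)* ∘ c_{A,B}` of the Yetter-Drinfeld category, a unitary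
operator from `A ⊗ B` to `B ⊗ A`. -/
def braiding (Fib : FibreFunctor.{v, u, w} C) (A B : YetterDrinfeld W) :
    Fib.obj (A.X ⊗ B.X) →L[ℂ] Fib.obj (B.X ⊗ A.X) :=
  ContinuousLinearMap.adjoint (starProduct Fib B.U A.V) ∘L Fib.map (β_ A.X B.X).hom

/-- The inverse of the (unitary) braiding. -/
def braidingInv (Fib : FibreFunctor.{v, u, w} C) (A B : YetterDrinfeld W) :
    Fib.obj (B.X ⊗ A.X) →L[ℂ] Fib.obj (A.X ⊗ B.X) :=
  ContinuousLinearMap.adjoint (braiding Fib A B)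

/-- Multiplicative unitaries in the Yetter-Drinfeld category: unitary morphisms
`F : L ⊗ L ⟶ L ⊗ L` of Yetter-Drinfeld modules solving the pentagon equation
`F₂₃ F₁₂ = F₁₂ (Φ⁻¹)₁₂ F₂₃ Φ₁₂ F₂₃` for the braiding `Φ = Φ_{L,L}`. -/
structure IsMultiplicativeUnitary (Fib : FibreFunctor.{v, u, w} C) (L : YetterDrinfeld W)
    (F : L.X ⊗ L.X ⟶ L.X ⊗ L.X) : Prop where
  unitary : IsUnitary F
  hom : IsTensorHom L L L L F
  pentagon : Fib.map (leg23 L.X F) ∘L Fib.map (F ▷ L.X) =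
    Fib.map (F ▷ L.X) ∘L
      (Fib.amp (braidingInv Fib L L) L.X ∘L Fib.map (leg23 L.X F) ∘L
        Fib.amp (braiding Fib L L) L.X) ∘L
      Fib.map (leg23 L.X F)

/-- Regularity in the Yetter-Drinfeld category: the closed linear span of the slices
`(id ⊗ ω)(Φ_{L,L}⁻¹ ∘ F)`, `ω ∈ B(L)_*`, is the space of compact operators. -/
def IsRegular (Fib : FibreFunctor.{v, u, w} C) (L : YetterDrinfeld W)
    (F : L.X ⊗ L.X ⟶ L.X ⊗ L.X) : Prop :=
  Fib.slices (braidingInv Fib L L ∘L Fib.map F) = Fib.compacts L.X L.X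

/-- The semi-direct product `W ⋉ F = W₁₃ U₂₃ V₃₄* F₂₄ V₃₄` on `K ⊗ L ⊗ K ⊗ L`, where `W₁₃` and
`F₂₄` pass in front of the leg in between. -/
def semidirect (L : YetterDrinfeld W) (F : L.X ⊗ L.X ⟶ L.X ⊗ L.X) :
    (K ⊗ L.X) ⊗ (K ⊗ L.X) ⟶ (K ⊗ L.X) ⊗ (K ⊗ L.X) :=
  (K ⊗ L.X) ◁ L.V ≫
  ((α_ K L.X (K ⊗ L.X)).hom ≫
    K ◁ ((α_ L.X K L.X).inv ≫ leg13Over K F ≫ (α_ L.X K L.X).hom) ≫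
    (α_ K L.X (K ⊗ L.X)).inv) ≫
  (K ⊗ L.X) ◁ CStarCategory.adj L.V ≫
  ((α_ K L.X (K ⊗ L.X)).hom ≫
    K ◁ ((α_ L.X K L.X).inv ≫ L.U ▷ L.X ≫ (α_ L.X K L.X).hom) ≫
    (α_ K L.X (K ⊗ L.X)).inv) ≫
  ((α_ (K ⊗ L.X) K L.X).inv ≫ leg13Over L.X W ▷ L.X ≫ (α_ (K ⊗ L.X) K L.X).hom)

end YetterDrinfeld

end

end

end BraidedMU

/-!
The proof computes the slices of `c⁻¹ (W ⋉ F)`. Write `w = c⁻¹ W`, `t = c⁻¹ U` and `P = Φ⁻¹ F` for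
the Yetter-Drinfeld module `(L, U, V)`, and `[·]` for closed linear spans. Naturality of the
braiding and the definition of `Φ` through the commutator of `U` and `V` give the factorization
`c⁻¹ (W ⋉ F) = A₁₂₃ t₃₄ P₂₃ (c⁻¹ V)₃₄` (`YetterDrinfeld.semidirect_braid_inv`), where
`A = c_{L,K}⁻¹ w₁₂ V₂₃* c_{L,K}` acts on `K ⊗ L ⊗ K`. The unitary `c⁻¹ V` only acts on sliced legs
and can be dropped.

Two general facts about a regular `W` enter. The slices of `t` span the compact operators
(`slices_corep`): by the corepresentation property, `t` can be traded for `w` on the last two legs.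
Hence `t` may be replaced by rank one operators, which cut the product into independent slices of
`A` and of `P` (`YetterDrinfeld.slices_semidirect`):
`[slices of c⁻¹ (W ⋉ F)] = [(slices of A) (id ⊗ slices of P)]`.
Secondly, `V ∗ U` exists (`exists_isStarProduct`), so that `Φ` is not a default value: the
commutator `U₁₂* V₂₃ U₁₂ V₂₃*` commutes with the slices of `w` on the middle leg, as follows from
the pentagon equations for `U` and `V` alone, and therefore with all compact operators there.

If `F` is regular, the slices of `P` may be replaced by rank one operators on `L`. These absorb the
unitaries `V` and `c` in `A`, and what is left are products of slices of `w` and of `c⁻¹`, which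
span the compact operators on `K ⊗ L` (`YetterDrinfeld.isRegular_semidirect`). Conversely, a fixed
vector `e` satisfies `w (e ⊗ ξ) = ξ ⊗ e`, so compressing `(slice of A) (id ⊗ p)` by `e` gives a
multiple of `p`. The compression maps compact operators to compact operators and reaches all those
of rank one when `e ≠ 0` (`YetterDrinfeld.isRegular_of_semidirect`).
-/

namespace BraidedMU

noncomputable section

/-! ### Closed linear spans -/

section ClosedSpan

variable {E F : Type*} [NormedAddCommGroup E] [NormedSpace ℂ E] [NormedAddCommGroup F]
  [NormedSpace ℂ F] {σ : ℂ →+* ℂ}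

/-- The closed linear span of a family of vectors. -/
def closedSpan {ι : Type*} (v : ι → E) : Submodule ℂ E :=
  (Submodule.span ℂ (Set.range v)).topologicalClosure

theorem mem_closedSpan {ι : Type*} (v : ι → E) (i : ι) : v i ∈ closedSpan v :=
  Submodule.le_topologicalClosure _ (Submodule.subset_span ⟨i, rfl⟩)

theorem isClosed_closedSpan {ι : Type*} (v : ι → E) : IsClosed (closedSpan v : Set E) :=
  Submodule.isClosed_topologicalClosure _

theorem closedSpan_le {ι : Type*} {v : ι → E} {M : Submodule ℂ E} (hM : IsClosed (M : Set E))
    (h : ∀ i, v i ∈ M) : closedSpan v ≤ M :=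
  Submodule.topologicalClosure_minimal _
    (Submodule.span_le.2 (by rintro _ ⟨i, rfl⟩; exact h i)) hM

theorem map_mem_of_mem_closedSpan [RingHomSurjective σ] {ι : Type*} {v : ι → E}
    (f : E →SL[σ] F) {M : Submodule ℂ F}
    (hM : IsClosed (M : Set F)) (h : ∀ i, f (v i) ∈ M) {x : E} (hx : x ∈ closedSpan v) :
    f x ∈ M :=
  closedSpan_le (M := M.comap (f : E →ₛₗ[σ] F)) (hM.preimage f.continuous) h hx

/-- In a family depending semilinearly and continuously on one parameter, that parameter may be
restricted to any family with the same closed linear span. -/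
theorem closedSpan_congr [RingHomSurjective σ] {κ ι ι' : Type*} (f : κ → E →SL[σ] F)
    {v : ι → E} {v' : ι' → E}
    (h : closedSpan v = closedSpan v') :
    closedSpan (fun p : κ × ι => f p.1 (v p.2)) =
      closedSpan (fun p : κ × ι' => f p.1 (v' p.2)) := by
  refine le_antisymm (closedSpan_le (isClosed_closedSpan _) fun p => ?_)
    (closedSpan_le (isClosed_closedSpan _) fun p => ?_)
  · exact map_mem_of_mem_closedSpan (f p.1) (isClosed_closedSpan _)
      (fun i => mem_closedSpan (fun p : κ × ι' => f p.1 (v' p.2)) (p.1, i))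
      (h ▸ mem_closedSpan v p.2)
  · exact map_mem_of_mem_closedSpan (f p.1) (isClosed_closedSpan _)
      (fun i => mem_closedSpan (fun p : κ × ι => f p.1 (v p.2)) (p.1, i))
      (h ▸ mem_closedSpan v' p.2)

theorem closedSpan_comp_surjective {ι κ : Type*} (v : ι → E) {e : κ → ι}
    (he : Function.Surjective e) : closedSpan (fun k => v (e k)) = closedSpan v := by
  unfold closedSpan
  rw [← he.range_comp v]
  rfl

theorem closedSpan_id : closedSpan (fun x : E => x) = ⊤ :=
  eq_top_iff.2 fun x _ => mem_closedSpan (fun x : E => x) x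

/-- A version of `closedSpan_congr` with freely chosen index types. -/
theorem closedSpan_exchange [RingHomSurjective σ] {κ ι ι' I I' : Type*} {v : ι → E} {v' : ι' → E}
    (h : closedSpan v = closedSpan v') (f : κ → E →SL[σ] F) {g : I → F} {g' : I' → F}
    (e : I → κ × ι) (e' : I' → κ × ι') (he : Function.Surjective e) (he' : Function.Surjective e')
    (hg : ∀ i, g i = f (e i).1 (v (e i).2)) (hg' : ∀ i, g' i = f (e' i).1 (v' (e' i).2)) :
    closedSpan g = closedSpan g' := by
  rw [funext hg, funext hg', closedSpan_comp_surjective (fun p : κ × ι => f p.1 (v p.2)) he,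
    closedSpan_comp_surjective (fun p : κ × ι' => f p.1 (v' p.2)) he', closedSpan_congr f h]

/-- A continuous linear surjection maps total families to total families. -/
theorem closedSpan_map_of_surjective [RingHomSurjective σ] {ι : Type*} {v : ι → E}
    (hv : closedSpan v = ⊤)
    (f : E →SL[σ] F) (hf : Function.Surjective f) : closedSpan (fun i => f (v i)) = ⊤ := by
  refine eq_top_iff.2 fun y _ => ?_
  obtain ⟨x, rfl⟩ := hf y
  exact map_mem_of_mem_closedSpan f (isClosed_closedSpan _)
    (fun i => mem_closedSpan (fun i => f (v i)) i) (by rw [hv]; trivial)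

end ClosedSpan

/-! ### Compact operators between Hilbert spaces -/

section Compact

open InnerProductSpace

variable {H H' : Type*} [NormedAddCommGroup H] [InnerProductSpace ℂ H] [NormedAddCommGroup H']
  [InnerProductSpace ℂ H']

theorem isClosed_compactOperator [CompleteSpace H'] :
    IsClosed (compactOperator (RingHom.id ℂ) H H' : Set (H →L[ℂ] H')) :=
  isClosed_setOfPred_isCompactOperator

theorem isCompactOperator_rankOne (a : H') (b : H) : IsCompactOperator (rankOne ℂ a b) := by
  rw [rankOne_def']
  exact (isCompactOperator_of_locallyCompactSpace_dom (innerSL ℂ b)).clm_comp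
    (ContinuousLinearMap.toSpanSingleton ℂ a)

/-- A compact operator into a Hilbert space is a norm limit of operators of finite rank: composing
it with the projection onto the span of an `ε`-net of the image of the unit ball changes it by at
most `ε`. -/
theorem compactOperator_eq_closedSpan_rankOne [CompleteSpace H] [CompleteSpace H'] :
    compactOperator (RingHom.id ℂ) H H' =
      closedSpan (fun p : H' × H => rankOne ℂ p.1 p.2) := by
  refine le_antisymm (fun T hT => ?_)
    (closedSpan_le isClosed_compactOperator fun p => isCompactOperator_rankOne p.1 p.2)
  have hT' : IsCompactOperator T := hT
  refine Metric.mem_closure_iff.2 fun ε hε => ?_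
  have htb := (hT'.isCompact_closure_image_closedBall 1).totallyBounded.subset subset_closure
  obtain ⟨t, ht, hcov⟩ := Metric.totallyBounded_iff.1 htb (ε / 2) (half_pos hε)
  have : FiniteDimensional ℂ (Submodule.span ℂ t) := FiniteDimensional.span_of_finite ℂ ht
  set V := Submodule.span ℂ t
  let b := stdOrthonormalBasis ℂ V
  refine ⟨V.starProjection ∘L T, ?_, ?_⟩
  · rw [b.starProjection_eq_sum_rankOne]
    have : (∑ i, rankOne ℂ (b i : H') (b i : H')) ∘L T =
        ∑ i, rankOne ℂ (b i : H') (ContinuousLinearMap.adjoint T (b i)) := by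
      ext x
      simp [ContinuousLinearMap.adjoint_inner_left]
    rw [this]
    exact Submodule.sum_mem _ fun i _ => Submodule.subset_span ⟨(_, _), rfl⟩
  · rw [dist_eq_norm]
    refine lt_of_le_of_lt ?_ (half_lt_self hε)
    refine ContinuousLinearMap.opNorm_le_of_unit_norm (half_pos hε).le fun x hx => ?_
    obtain ⟨y, hy, hxy⟩ := Set.mem_iUnion₂.1 (hcov ⟨x, by simp [hx], rfl⟩)
    have hmin := V.starProjection_minimal (T x)
    have : ‖T x - V.starProjection (T x)‖ ≤ ‖T x - y‖ := by
      rw [hmin]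
      exact ciInf_le ⟨0, by rintro _ ⟨z, rfl⟩; exact norm_nonneg _⟩
        (⟨y, Submodule.subset_span hy⟩ : V)
    rw [Metric.mem_ball, dist_eq_norm] at hxy
    exact this.trans hxy.le

theorem rankOne_mem_compactOperator (a : H') (b : H) :
    rankOne ℂ a b ∈ compactOperator (RingHom.id ℂ) H H' :=
  isCompactOperator_rankOne a b

/-- The rank one operators `|a⟩⟨b|`, with `a` and `b` in total families, span the compact
operators. -/
theorem compactOperator_eq_closedSpan_rankOne_of_total [CompleteSpace H] [CompleteSpace H']
    {ι κ : Type*} {a : ι → H'} {b : κ → H} (ha : closedSpan a = ⊤) (hb : closedSpan b = ⊤) :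
    compactOperator (RingHom.id ℂ) H H' =
      closedSpan (fun p : ι × κ => rankOne ℂ (a p.1) (b p.2)) := by
  refine le_antisymm ?_
    (closedSpan_le isClosed_compactOperator fun p => rankOne_mem_compactOperator _ _)
  rw [compactOperator_eq_closedSpan_rankOne]
  refine closedSpan_le (isClosed_closedSpan _) fun p => ?_
  refine map_mem_of_mem_closedSpan (rankOne ℂ p.1) (isClosed_closedSpan _) (v := b) (fun j => ?_)
    (by rw [hb]; trivial)
  refine map_mem_of_mem_closedSpan ((rankOne ℂ).flip (b j)) (isClosed_closedSpan _) (v := a)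
    (fun i => ?_) (by rw [ha]; trivial)
  exact mem_closedSpan (fun p : ι × κ => rankOne ℂ (a p.1) (b p.2)) (i, j)

end Compact

end

noncomputable section

open InnerProductSpace ContinuousLinearMap

variable {C : Type u} [Category.{v} C] [Preadditive C] [Linear ℂ C] [MonoidalCategory C]
  [MonoidalPreadditive C] [MonoidalLinear ℂ C] [MonoidalWStarCategory C]

namespace FibreFunctor

variable (Fib : FibreFunctor.{v, u, w} C)

/-! ### Product vectors, kets and bras -/

/-- The operator `x ↦ x ⊗ y`, as a bounded linear function of `y`. -/
def ketL (X Y : C) : Fib.obj Y →L[ℂ] Fib.obj X →L[ℂ] Fib.obj (X ⊗ Y) :=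
  (ContinuousLinearMap.compL ℂ _ _ _ (Fib.μ X Y).toContinuousLinearMap) ∘L
    (TensorProduct.mkL ℂ (Fib.obj X) (Fib.obj Y)).flip

theorem ketL_apply (X Y : C) (y : Fib.obj Y) : Fib.ketL X Y y = Fib.ket X y := rfl

theorem ket_apply (X : C) {Y : C} (y : Fib.obj Y) (x : Fib.obj X) :
    Fib.ket X y x = Fib.μ X Y (x ⊗ₜ[ℂ] y) := rfl

/-- The operator `id ⊗ ⟨y|` from `obj (X ⊗ Y)` to `obj X`, adjoint to `ket X y`. -/
def bra (X : C) {Y : C} (y : Fib.obj Y) : Fib.obj (X ⊗ Y) →L[ℂ] Fib.obj X :=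
  adjoint (Fib.ket X y)

/-- The operator `id ⊗ ⟨y|`, as a bounded conjugate-linear function of `y`. -/
def braL (X Y : C) : Fib.obj Y →L⋆[ℂ] Fib.obj (X ⊗ Y) →L[ℂ] Fib.obj X :=
  (adjoint (𝕜 := ℂ) (E := Fib.obj X)
    (F := Fib.obj (X ⊗ Y))).toContinuousLinearEquiv.toContinuousLinearMap.comp (Fib.ketL X Y)

theorem bra_tmul (X : C) {Y : C} (y : Fib.obj Y) (x : Fib.obj X) (y' : Fib.obj Y) :
    Fib.bra X y (Fib.μ X Y (x ⊗ₜ[ℂ] y')) = ⟪y, y'⟫_ℂ • x := by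
  refine ext_inner_left ℂ fun z => ?_
  rw [bra, adjoint_inner_right, ket_apply, LinearIsometry.inner_map_map,
    TensorProduct.inner_tmul, inner_smul_right, mul_comm]

/-- Product vectors are total. -/
theorem closedSpan_tmul (X Y : C) :
    closedSpan (fun p : Fib.obj X × Fib.obj Y => Fib.μ X Y (p.1 ⊗ₜ[ℂ] p.2)) = ⊤ := by
  refine eq_top_iff.2 fun x _ => ?_
  have hx : x ∈ closure (Set.range (Fib.μ X Y)) := Fib.μ_dense X Y x
  refine closure_minimal ?_ (isClosed_closedSpan _) hx
  rintro _ ⟨t, rfl⟩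
  induction t using TensorProduct.induction_on with
  | zero => simp
  | tmul a b =>
    exact mem_closedSpan (fun p : Fib.obj X × Fib.obj Y => Fib.μ X Y (p.1 ⊗ₜ[ℂ] p.2)) (a, b)
  | add s t hs ht => rw [LinearIsometry.map_add]; exact Submodule.add_mem _ hs ht

variable {Fib} in
theorem hom_ext {H : Type*} [NormedAddCommGroup H] [NormedSpace ℂ H] {X Y : C}
    {S T : Fib.obj (X ⊗ Y) →L[ℂ] H}
    (h : ∀ x y, S (Fib.μ X Y (x ⊗ₜ[ℂ] y)) = T (Fib.μ X Y (x ⊗ₜ[ℂ] y))) : S = T := by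
  ext z
  have hz : z ∈ closedSpan (fun p : Fib.obj X × Fib.obj Y => Fib.μ X Y (p.1 ⊗ₜ[ℂ] p.2)) := by
    rw [closedSpan_tmul]; trivial
  have := map_mem_of_mem_closedSpan (S - T) (M := ⊥) isClosed_singleton
    (fun p => by simp [h]) hz
  simpa [sub_eq_zero] using this

variable {Fib} in
theorem hom_ext_ket {H : Type*} [NormedAddCommGroup H] [NormedSpace ℂ H] {X Y : C}
    {S T : Fib.obj (X ⊗ Y) →L[ℂ] H}
    (h : ∀ y, S ∘L Fib.ket X y = T ∘L Fib.ket X y) : S = T :=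
  hom_ext fun x y => congrArg (fun R : Fib.obj X →L[ℂ] H => R x) (h y)

theorem map_whiskerRight_ket {X X' : C} (f : X ⟶ X') (Y : C) (y : Fib.obj Y) :
    Fib.map (f ▷ Y) ∘L Fib.ket X y = Fib.ket X' y ∘L Fib.map f := by
  ext x
  exact Fib.μ_natural_left f Y x y

theorem bra_map_whiskerRight {X X' : C} (f : X ⟶ X') (Y : C) (y : Fib.obj Y) :
    Fib.bra X' y ∘L Fib.map (f ▷ Y) = Fib.map f ∘L Fib.bra X y := by
  refine hom_ext fun x y' => ?_
  simp [Fib.μ_natural_left, bra_tmul]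

theorem bra_amp {A B : C} (T : Fib.obj A →L[ℂ] Fib.obj B) (Z : C) (z : Fib.obj Z) :
    Fib.bra B z ∘L Fib.amp T Z = T ∘L Fib.bra A z := by
  refine hom_ext fun x y' => ?_
  simp [Fib.amp_tmul, bra_tmul]

theorem amp_ket {A B : C} (T : Fib.obj A →L[ℂ] Fib.obj B) (Z : C) (z : Fib.obj Z) :
    Fib.amp T Z ∘L Fib.ket A z = Fib.ket B z ∘L T := by
  ext x
  exact Fib.amp_tmul T Z x z

theorem amp_map {A B : C} (f : A ⟶ B) (Z : C) : Fib.amp (Fib.map f) Z = Fib.map (f ▷ Z) :=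
  hom_ext fun x y => by rw [Fib.amp_tmul, Fib.μ_natural_left]

theorem amp_comp {A B D : C} (S : Fib.obj B →L[ℂ] Fib.obj D) (T : Fib.obj A →L[ℂ] Fib.obj B)
    (Z : C) : Fib.amp (S ∘L T) Z = Fib.amp S Z ∘L Fib.amp T Z :=
  hom_ext fun x y => by simp [Fib.amp_tmul]

theorem bra_map_whiskerLeft (X : C) {Y Y' : C} (g : Y ⟶ Y') (y : Fib.obj Y') :
    Fib.bra X y ∘L Fib.map (X ◁ g) = Fib.bra X (adjoint (Fib.map g) y) := by
  refine hom_ext fun x y' => ?_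
  simp [Fib.μ_natural_right, bra_tmul, adjoint_inner_left]

theorem map_assoc_ket_ket (X : C) {Y Z : C} (y : Fib.obj Y) (z : Fib.obj Z) :
    Fib.map (α_ X Y Z).hom ∘L Fib.ket (X ⊗ Y) z ∘L Fib.ket X y =
      Fib.ket X (Fib.μ Y Z (y ⊗ₜ[ℂ] z)) := by
  ext x
  exact Fib.μ_assoc X Y Z x y z

theorem map_hom_inv_apply {X Y : C} (e : X ≅ Y) (x : Fib.obj X) :
    Fib.map e.inv (Fib.map e.hom x) = x := by
  have := Fib.map_comp e.hom e.inv
  rw [e.hom_inv_id, Fib.map_id] at this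
  exact (congrArg (fun T : Fib.obj X →L[ℂ] Fib.obj X => T x) this).symm

theorem map_assoc_inv_tmul {X Y Z : C} (x : Fib.obj X) (y : Fib.obj Y) (z : Fib.obj Z) :
    Fib.map (α_ X Y Z).inv (Fib.μ X (Y ⊗ Z) (x ⊗ₜ[ℂ] Fib.μ Y Z (y ⊗ₜ[ℂ] z))) =
      Fib.μ (X ⊗ Y) Z (Fib.μ X Y (x ⊗ₜ[ℂ] y) ⊗ₜ[ℂ] z) := by
  rw [← Fib.μ_assoc, map_hom_inv_apply]

theorem bra_bra_map_assoc_inv (X : C) {Y Z : C} (y : Fib.obj Y) (z : Fib.obj Z) :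
    Fib.bra X y ∘L Fib.bra (X ⊗ Y) z ∘L Fib.map (α_ X Y Z).inv =
      Fib.bra X (Fib.μ Y Z (y ⊗ₜ[ℂ] z)) := by
  refine hom_ext_ket fun v => ?_
  have hv : v ∈ closedSpan (fun p : Fib.obj Y × Fib.obj Z => Fib.μ Y Z (p.1 ⊗ₜ[ℂ] p.2)) := by
    rw [closedSpan_tmul]; trivial
  ext x
  have := map_mem_of_mem_closedSpan
    (((Fib.bra X y ∘L Fib.bra (X ⊗ Y) z ∘L Fib.map (α_ X Y Z).inv) -
      Fib.bra X (Fib.μ Y Z (y ⊗ₜ[ℂ] z))) ∘L (Fib.ketL X (Y ⊗ Z)).flip x)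
    (M := ⊥) isClosed_singleton (fun p => ?_) hv
  · simpa [sub_eq_zero, ketL_apply] using this
  · simp [ketL_apply, ket_apply, map_assoc_inv_tmul, bra_tmul, smul_smul, mul_comm]

/-! ### Operators on the right leg -/

/-- The operator `id ⊗ T` from `obj (A ⊗ B)` to `obj (A ⊗ B')`, as a bounded linear function of
`T`, which need not come from a morphism of `C`. -/
def lamp (A : C) {B B' : C} :
    (Fib.obj B →L[ℂ] Fib.obj B') →L[ℂ] Fib.obj (A ⊗ B) →L[ℂ] Fib.obj (A ⊗ B') :=
  have ext_tmul : ∀ (T : Fib.obj B →L[ℂ] Fib.obj B') (a : Fib.obj A) (b : Fib.obj B),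
      (((Fib.μ A B').toContinuousLinearMap ∘L T.lTensor (Fib.obj A)).extend
        (Fib.μ A B).toContinuousLinearMap) (Fib.μ A B (a ⊗ₜ[ℂ] b)) =
      Fib.μ A B' (a ⊗ₜ[ℂ] T b) := fun T a b => by
    have h := ContinuousLinearMap.extend_eq
      ((Fib.μ A B').toContinuousLinearMap ∘L T.lTensor (Fib.obj A))
      (e := (Fib.μ A B).toContinuousLinearMap) (Fib.μ_dense A B)
      (Fib.μ A B).isometry.isUniformInducing (a ⊗ₜ[ℂ] b)
    simpa using h
  LinearMap.mkContinuous
    { toFun := fun T => ((Fib.μ A B').toContinuousLinearMap ∘L T.lTensor (Fib.obj A)).extend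
        (Fib.μ A B).toContinuousLinearMap
      map_add' := fun S T => hom_ext fun a b => by
        simp only [add_apply, ext_tmul, TensorProduct.tmul_add, LinearIsometry.map_add]
      map_smul' := fun c T => hom_ext fun a b => by
        simp only [smul_apply, ext_tmul, TensorProduct.tmul_smul, LinearIsometry.map_smul,
          RingHom.id_apply] }
    1 fun T => by
      refine (opNorm_extend_le (N := 1) _ (Fib.μ_dense A B) fun x => ?_).trans ?_
      · simp
      · rw [NNReal.coe_one]
        gcongr
        refine (opNorm_comp_le _ _).trans ?_
        refine (mul_le_mul (Fib.μ A B').norm_toContinuousLinearMap_le (norm_lTensor_le _ _)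
          (opNorm_nonneg _) zero_le_one).trans ?_
        rw [one_mul]

theorem lamp_tmul (A : C) {B B' : C} (T : Fib.obj B →L[ℂ] Fib.obj B') (a : Fib.obj A)
    (b : Fib.obj B) :
    Fib.lamp A T (Fib.μ A B (a ⊗ₜ[ℂ] b)) = Fib.μ A B' (a ⊗ₜ[ℂ] T b) := by
  rw [lamp, LinearMap.mkContinuous_apply]
  have h := ContinuousLinearMap.extend_eq
    ((Fib.μ A B').toContinuousLinearMap ∘L T.lTensor (Fib.obj A))
    (e := (Fib.μ A B).toContinuousLinearMap) (Fib.μ_dense A B)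
    (Fib.μ A B).isometry.isUniformInducing (a ⊗ₜ[ℂ] b)
  simpa using h

theorem lamp_map (A : C) {B B' : C} (g : B ⟶ B') : Fib.lamp A (Fib.map g) = Fib.map (A ◁ g) :=
  hom_ext fun x y => by rw [Fib.lamp_tmul, Fib.μ_natural_right]

theorem lamp_rankOne (A : C) {B B' : C} (b : Fib.obj B') (b' : Fib.obj B) :
    Fib.lamp A (rankOne ℂ b b') = Fib.ket A b ∘L Fib.bra A b' := by
  refine hom_ext fun x y => ?_
  simp [lamp_tmul, bra_tmul, ket_apply, TensorProduct.tmul_smul]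

theorem lamp_amp (A : C) {B B' : C} (T : Fib.obj B →L[ℂ] Fib.obj B') (D : C) :
    Fib.map (α_ A B' D).inv ∘L Fib.lamp A (Fib.amp T D) ∘L Fib.map (α_ A B D).hom =
      Fib.amp (Fib.lamp A T) D := by
  refine hom_ext_ket fun d => hom_ext fun a b => ?_
  simp only [ContinuousLinearMap.comp_apply, ket_apply, Fib.μ_assoc, lamp_tmul, amp_tmul,
    map_assoc_inv_tmul]

/-- Slicing the last leg of `id ⊗ T` gives `id ⊗` the slice of `T`. -/
theorem bra_lamp_ket (A : C) {Y Z Y' Z' : C} (T : Fib.obj (Y ⊗ Z) →L[ℂ] Fib.obj (Y' ⊗ Z'))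
    (z : Fib.obj Z) (z' : Fib.obj Z') :
    Fib.bra (A ⊗ Y') z' ∘L
        (Fib.map (α_ A Y' Z').inv ∘L Fib.lamp A T ∘L Fib.map (α_ A Y Z).hom) ∘L
        Fib.ket (A ⊗ Y) z =
      Fib.lamp A (Fib.bra Y' z' ∘L T ∘L Fib.ket Y z) := by
  refine hom_ext fun a y => ?_
  simp only [ContinuousLinearMap.comp_apply, ket_apply, Fib.μ_assoc, lamp_tmul]
  generalize T (Fib.μ Y Z (y ⊗ₜ[ℂ] z)) = v
  have hv : v ∈ closedSpan (fun p : Fib.obj Y' × Fib.obj Z' => Fib.μ Y' Z' (p.1 ⊗ₜ[ℂ] p.2)) := by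
    rw [closedSpan_tmul]; trivial
  have := map_mem_of_mem_closedSpan
    ((Fib.bra (A ⊗ Y') z' ∘L Fib.map (α_ A Y' Z').inv ∘L (Fib.ketL A (Y' ⊗ Z')).flip a) -
      ((Fib.ketL A Y').flip a ∘L Fib.bra Y' z'))
    (M := ⊥) isClosed_singleton (fun p => ?_) hv
  · simpa [sub_eq_zero, ketL_apply, ket_apply] using this
  · simp [ketL_apply, ket_apply, map_assoc_inv_tmul, bra_tmul]

/-! ### Slices -/

/-- The slices by normal functionals have the same closed linear span as the slices by vector
functionals. -/
theorem slices_eq_closedSpan {X Y X' Y' : C} (T : Fib.obj (X ⊗ Y) →L[ℂ] Fib.obj (X' ⊗ Y')) :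
    Fib.slices T = closedSpan (fun p : Fib.obj Y × Fib.obj Y' =>
      Fib.bra X' p.2 ∘L T ∘L Fib.ket X p.1) := by
  refine le_antisymm (closedSpan_le (v := Fib.slice T) (isClosed_closedSpan _) fun ω => ?_)
    (closedSpan_le (isClosed_closedSpan (Fib.slice T)) fun p => ?_)
  · by_cases h : Summable fun n =>
      adjoint (Fib.ket X' (ω.η n)) ∘L T ∘L Fib.ket X (ω.ξ n)
    · refine (isClosed_closedSpan _).mem_of_tendsto h.hasSum (Filter.Eventually.of_forall fun s =>
        Submodule.sum_mem _ fun n _ => ?_)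
      exact mem_closedSpan (fun p : Fib.obj Y × Fib.obj Y' =>
        Fib.bra X' p.2 ∘L T ∘L Fib.ket X p.1) (ω.ξ n, ω.η n)
    · rw [slice, tsum_eq_zero_of_not_summable h]
      exact Submodule.zero_mem _
  · let ω : NormalFunctional (Fib.obj Y) (Fib.obj Y') :=
      { ξ := fun n => if n = 0 then p.1 else 0
        η := fun n => if n = 0 then p.2 else 0
        summable_ξ := summable_of_ne_finset_zero (s := {0}) fun n hn => by
          simp [Finset.notMem_singleton.1 hn]
        summable_η := summable_of_ne_finset_zero (s := {0}) fun n hn => by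
          simp [Finset.notMem_singleton.1 hn] }
    have hω : Fib.slice T ω = Fib.bra X' p.2 ∘L T ∘L Fib.ket X p.1 := by
      rw [slice, tsum_eq_single 0 fun n hn => ?_]
      · simp [ω, bra]
      · have : Fib.ket X (0 : Fib.obj Y) = 0 := by rw [← ketL_apply, map_zero]
        simp [ω, hn, this]
    rw [← hω]
    exact mem_closedSpan (Fib.slice T) ω

/-- The vectors defining the vector functionals may be restricted to total families. -/
theorem slices_eq_closedSpan_of_total {X Y X' Y' : C}
    (T : Fib.obj (X ⊗ Y) →L[ℂ] Fib.obj (X' ⊗ Y')) {ι κ : Type*} {y : ι → Fib.obj Y}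
    {y' : κ → Fib.obj Y'} (hy : closedSpan y = ⊤) (hy' : closedSpan y' = ⊤) :
    Fib.slices T = closedSpan (fun p : ι × κ =>
      Fib.bra X' (y' p.2) ∘L T ∘L Fib.ket X (y p.1)) := by
  rw [slices_eq_closedSpan]
  refine le_antisymm (closedSpan_le (isClosed_closedSpan _) fun p => ?_)
    (closedSpan_le (isClosed_closedSpan _) fun p => ?_)
  · have h1 (i : ι) : Fib.bra X' p.2 ∘L T ∘L Fib.ket X (y i) ∈ closedSpan (fun p : ι × κ =>
        Fib.bra X' (y' p.2) ∘L T ∘L Fib.ket X (y p.1)) :=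
      map_mem_of_mem_closedSpan
        (((compL ℂ _ _ _).flip (T ∘L Fib.ket X (y i))).comp (Fib.braL X' Y'))
        (isClosed_closedSpan _) (v := y') (fun j => mem_closedSpan (fun p : ι × κ =>
        Fib.bra X' (y' p.2) ∘L T ∘L Fib.ket X (y p.1)) (i, j)) (by rw [hy']; trivial)
    exact map_mem_of_mem_closedSpan
        ((compL ℂ _ _ _ (Fib.bra X' p.2 ∘L T)).comp (Fib.ketL X Y))
        (isClosed_closedSpan _) (v := y) h1 (by rw [hy]; trivial)
  · exact mem_closedSpan (fun p : Fib.obj Y × Fib.obj Y' =>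
      Fib.bra X' p.2 ∘L T ∘L Fib.ket X p.1) (y p.1, y' p.2)

end FibreFunctor

end

/-! ### Strand calculus in a braided monoidal category -/

section Strands

variable {C : Type u} [Category.{v} C] [MonoidalCategory C]

/-- A morphism on the last two legs of a left-bracketed triple tensor product. -/
def at23 (A : C) {B D B' D' : C} (T : B ⊗ D ⟶ B' ⊗ D') : (A ⊗ B) ⊗ D ⟶ (A ⊗ B') ⊗ D' :=
  (α_ A B D).hom ≫ A ◁ T ≫ (α_ A B' D').inv

/-- A morphism of left-bracketed triple tensor products, put on the last three of four legs. -/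
def at234 (A : C) {B D E B' D' E' : C} (S : (B ⊗ D) ⊗ E ⟶ (B' ⊗ D') ⊗ E') :
    ((A ⊗ B) ⊗ D) ⊗ E ⟶ ((A ⊗ B') ⊗ D') ⊗ E' :=
  (α_ A B D).hom ▷ E ≫ at23 A S ≫ (α_ A B' D').inv ▷ E'

theorem at23_comp (A : C) {B D B' D' B'' D'' : C} (S : B ⊗ D ⟶ B' ⊗ D')
    (T : B' ⊗ D' ⟶ B'' ⊗ D'') : at23 A S ≫ at23 A T = at23 A (S ≫ T) := by
  simp [at23]

theorem at23_id (A B D : C) : at23 A (𝟙 (B ⊗ D)) = 𝟙 _ := by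
  simp [at23]

theorem at234_comp (A : C) {B D E B' D' E' B'' D'' E'' : C}
    (S : (B ⊗ D) ⊗ E ⟶ (B' ⊗ D') ⊗ E') (T : (B' ⊗ D') ⊗ E' ⟶ (B'' ⊗ D'') ⊗ E'') :
    at234 A S ≫ at234 A T = at234 A (S ≫ T) := by
  simp [at234, at23]

theorem at234_whiskerRight (A : C) {B D B' D' : C} (T : B ⊗ D ⟶ B' ⊗ D') (E : C) :
    at234 A (T ▷ E) = at23 A T ▷ E := by
  simp [at234, at23]

theorem at234_at23 (A B : C) {D E D' E' : C} (T : D ⊗ E ⟶ D' ⊗ E') :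
    at234 A (at23 B T) = at23 (A ⊗ B) T := by
  simp only [at234, at23]
  monoidal

theorem whiskerRight_at23_exchange {A A' : C} (f : A ⟶ A') {D E D' E' : C}
    (T : D ⊗ E ⟶ D' ⊗ E') :
    (f ▷ D) ▷ E ≫ at23 A' T = at23 A T ≫ (f ▷ D') ▷ E' := by
  rw [at23, at23, associator_naturality_left_assoc, ← whisker_exchange_assoc,
    associator_inv_naturality_left]
  simp only [Category.assoc]

theorem leg23_eq_at23 (A : C) {B D : C} (T : B ⊗ D ⟶ B ⊗ D) : leg23 A T = at23 A T := rfl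

variable [BraidedCategory C]

theorem braid_last_to_front {A B A' B' : C} (T : A ⊗ B ⟶ A' ⊗ B') (D : C) :
    T ▷ D ≫ at23 A' (β_ B' D).hom ≫ (β_ A' D).hom ▷ B' =
      at23 A (β_ B D).hom ≫ (β_ A D).hom ▷ B ≫ at23 D T := by
  have h := BraidedCategory.braiding_naturality_left T D
  rw [← cancel_mono (α_ D A' B').hom]
  simpa [at23] using h

theorem braid_inv_last_to_front {A B A' B' : C} (T : A ⊗ B ⟶ A' ⊗ B') (D : C) :
    T ▷ D ≫ at23 A' (β_ D B').inv ≫ (β_ D A').inv ▷ B' =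
      at23 A (β_ D B).inv ≫ (β_ D A).inv ▷ B ≫ at23 D T := by
  have h := BraidedCategory.braiding_inv_naturality_left T D
  rw [← cancel_mono (α_ D A' B').hom]
  simpa [at23] using h

theorem braid_first_to_back (A : C) {B D B' D' : C} (T : B ⊗ D ⟶ B' ⊗ D') :
    at23 A T ≫ (β_ A B').hom ▷ D' ≫ at23 B' (β_ A D').hom =
      (β_ A B).hom ▷ D ≫ at23 B (β_ A D).hom ≫ T ▷ A := by
  have h := BraidedCategory.braiding_naturality_right A T
  rw [← cancel_epi (α_ A B D).inv]
  simpa [at23] using h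

theorem braid_inv_first_to_back (A : C) {B D B' D' : C} (T : B ⊗ D ⟶ B' ⊗ D') :
    at23 A T ≫ (β_ B' A).inv ▷ D' ≫ at23 B' (β_ D' A).inv =
      (β_ B A).inv ▷ D ≫ at23 B (β_ D A).inv ≫ T ▷ A := by
  have h := BraidedCategory.braiding_inv_naturality_right A T
  rw [← cancel_epi (α_ A B D).inv]
  simpa [at23] using h

theorem at23_braid_hom_inv (A B D : C) :
    at23 A (β_ B D).hom ≫ at23 A (β_ B D).inv = 𝟙 _ := by
  rw [at23_comp, Iso.hom_inv_id, at23_id]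

theorem at23_braid_inv_hom (A B D : C) :
    at23 A (β_ B D).inv ≫ at23 A (β_ B D).hom = 𝟙 _ := by
  rw [at23_comp, Iso.inv_hom_id, at23_id]

theorem leg13Over_eq {A B : C} (Y : C) (T : A ⊗ B ⟶ A ⊗ B) :
    leg13Over Y T = (β_ A Y).hom ▷ B ≫ at23 Y T ≫ (β_ A Y).inv ▷ B := rfl

/-- The leg in the middle may be moved out of the way to the right instead of to the left. -/
theorem leg13Over_eq_conj_right {A B : C} (Y : C) (T : A ⊗ B ⟶ A ⊗ B) :
    leg13Over Y T = at23 A (β_ B Y).inv ≫ T ▷ Y ≫ at23 A (β_ B Y).hom := by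
  have h := braid_last_to_front T Y
  calc leg13Over Y T = (at23 A (β_ B Y).inv ≫ at23 A (β_ B Y).hom) ≫ (β_ A Y).hom ▷ B ≫
        at23 Y T ≫ (β_ A Y).inv ▷ B := by
        rw [at23_braid_inv_hom, Category.id_comp, leg13Over_eq]
    _ = _ := by
        rw [Category.assoc, ← reassoc_of% h, hom_inv_whiskerRight, Category.comp_id]

end Strands

/-! ### Braid identities for representations and corepresentations -/

section Identities

variable {C : Type u} [Category.{v} C]

/-- With `u = U₁₂`, `u₁₃ = U₁₃`, `v = V₃₄`, `v₂₄ = V₂₄` and `w = W₂₃`, this says that the commutator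
of `U` and `V` over the second leg is carried by `W₂₃` to the one over the third leg. Primes
denote inverses, and composition is in diagrammatic order. -/
theorem commutator_conj {Q : C} {w u u' u₁₃ u₁₃' v v' v₂₄ v₂₄' : Q ⟶ Q}
    (hu : u ≫ w = w ≫ u₁₃ ≫ u) (hv : w ≫ v = v ≫ v₂₄ ≫ w) (huv : u ≫ v = v ≫ u)
    (uu' : u ≫ u' = 𝟙 Q) (u'u : u' ≫ u = 𝟙 Q) (u₁₃u₁₃' : u₁₃ ≫ u₁₃' = 𝟙 Q)
    (vv' : v ≫ v' = 𝟙 Q) (v'v : v' ≫ v = 𝟙 Q) (v₂₄'v₂₄ : v₂₄' ≫ v₂₄ = 𝟙 Q) :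
    w ≫ v' ≫ u₁₃ ≫ v ≫ u₁₃' = v₂₄' ≫ u ≫ v₂₄ ≫ u' ≫ w := by
  have e1 : w ≫ v' = v₂₄' ≫ v' ≫ w := by
    calc w ≫ v' = v₂₄' ≫ v' ≫ (v ≫ v₂₄ ≫ w) ≫ v' := by
          simp only [Category.assoc]
          rw [reassoc_of% v'v, reassoc_of% v₂₄'v₂₄]
      _ = v₂₄' ≫ v' ≫ w := by rw [← hv, Category.assoc, vv', Category.comp_id]
  have e2 : w ≫ u₁₃ = u ≫ w ≫ u' := by
    rw [reassoc_of% hu, uu', Category.comp_id]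
  have e3 : v' ≫ u = u ≫ v' := by
    calc v' ≫ u = v' ≫ (u ≫ v) ≫ v' := by rw [Category.assoc, vv', Category.comp_id]
      _ = u ≫ v' := by rw [huv, Category.assoc, reassoc_of% v'v]
  have e4 : u' ≫ v = v ≫ u' := by
    calc u' ≫ v = u' ≫ (v ≫ u) ≫ u' := by rw [Category.assoc, uu', Category.comp_id]
      _ = v ≫ u' := by rw [← huv, Category.assoc, reassoc_of% u'u]
  have e5 : w ≫ u' ≫ u₁₃' = u' ≫ w := by
    calc w ≫ u' ≫ u₁₃' = u' ≫ (u ≫ w) ≫ u' ≫ u₁₃' := by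
          rw [Category.assoc, reassoc_of% u'u]
      _ = u' ≫ w := by
          rw [hu]
          simp only [Category.assoc]
          rw [reassoc_of% uu', u₁₃u₁₃', Category.comp_id]
  rw [reassoc_of% e1, reassoc_of% e2, reassoc_of% e4, reassoc_of% e3, reassoc_of% hv,
    reassoc_of% v'v, e5]

variable [MonoidalCategory C]

instance isIso_at23 (A : C) {B D B' D' : C} (T : B ⊗ D ⟶ B' ⊗ D') [IsIso T] :
    IsIso (at23 A T) := by
  unfold at23
  infer_instance

theorem whiskerLeft_eq_at23 (D : C) {A B A' B' : C} (T : A ⊗ B ⟶ A' ⊗ B') :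
    D ◁ T = (α_ D A B).inv ≫ at23 D T ≫ (α_ D A' B').hom := by
  simp [at23]

theorem whiskerLeft_assoc_eq_at234 (A : C) {B D E B' D' E' : C}
    (S : (B ⊗ D) ⊗ E ⟶ (B' ⊗ D') ⊗ E') :
    (α_ A B (D ⊗ E)).hom ≫ A ◁ ((α_ B D E).inv ≫ S ≫ (α_ B' D' E').hom) ≫
        (α_ A B' (D' ⊗ E')).inv =
      (α_ (A ⊗ B) D E).inv ≫ at234 A S ≫ (α_ (A ⊗ B') D' E').hom := by
  simp only [at234, at23]
  monoidal

variable [BraidedCategory C] {X X' K : C} {W : K ⊗ K ⟶ K ⊗ K}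

/-- For a corepresentation `U`, moving `U` past `c⁻¹ W` turns it into an operator on the last two
legs. -/
theorem corep_braid_inv {U : X ⊗ K ⟶ X ⊗ K}
    (corep : U ▷ K ≫ leg23 X W = leg23 X W ≫ leg13Over K U ≫ U ▷ K) :
    at23 X (W ≫ (β_ K K).inv) ≫ (U ≫ (β_ K X).inv) ▷ K ≫ at23 K U =
      U ▷ K ≫ at23 X (W ≫ (β_ K K).inv) ≫ (β_ K X).inv ▷ K := by
  rw [leg13Over_eq_conj_right, leg23_eq_at23] at corep
  simp only [Category.assoc] at corep
  simp only [← at23_comp, comp_whiskerRight, Category.assoc]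
  rw [reassoc_of% corep, braid_inv_last_to_front U K, reassoc_of% (at23_braid_hom_inv X K K)]

/-- The commutator of a corepresentation `U` and a representation `V`, moved to the outer legs so
that it passes in front of the middle leg, commutes with `c⁻¹ W` on the last leg and a further
one. Only the two pentagon equations for `U` and `V` enter. -/
theorem commutator_comm_braid_inv {U U' : X ⊗ K ⟶ X ⊗ K} {V V' : K ⊗ X' ⟶ K ⊗ X'}
    (corep : U ▷ K ≫ leg23 X W = leg23 X W ≫ leg13Over K U ≫ U ▷ K)
    (rep : W ▷ X' ≫ leg23 K V = leg23 K V ≫ leg13Over K V ≫ W ▷ X')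
    (UU' : U ≫ U' = 𝟙 _) (U'U : U' ≫ U = 𝟙 _) (VV' : V ≫ V' = 𝟙 _) (V'V : V' ≫ V = 𝟙 _)
    {q : (X ⊗ X') ⊗ K ⟶ (X ⊗ X') ⊗ K}
    (hq : q = at23 X (β_ X' K).hom ≫ (at23 X V' ≫ U ▷ X' ≫ at23 X V ≫ U' ▷ X') ≫
      at23 X (β_ X' K).inv) :
    q ▷ K ≫ at23 (X ⊗ X') (W ≫ (β_ K K).inv) =
      at23 (X ⊗ X') (W ≫ (β_ K K).inv) ≫ q ▷ K := by
  obtain ⟨G, hG⟩ : ∃ G : ((X ⊗ X') ⊗ K) ⊗ K ⟶ ((X ⊗ K) ⊗ K) ⊗ X',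
    G = at23 X (β_ X' K).hom ▷ K ≫ at23 (X ⊗ K) (β_ X' K).hom := ⟨_, rfl⟩
  obtain ⟨Y, hY⟩ : ∃ Y : ((X ⊗ K) ⊗ K) ⊗ X' ⟶ ((X ⊗ K) ⊗ K) ⊗ X',
    Y = at234 X (leg13Over K V') ≫ (U ▷ K) ▷ X' ≫ at234 X (leg13Over K V) ≫ (U' ▷ K) ▷ X' :=
      ⟨_, rfl⟩
  obtain ⟨w, hw⟩ : ∃ w : (X ⊗ K) ⊗ K ⟶ (X ⊗ K) ⊗ K, w = at23 X (W ≫ (β_ K K).inv) := ⟨_, rfl⟩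
  have hGw : at23 (X ⊗ X') (W ≫ (β_ K K).inv) ≫ G = G ≫ w ▷ X' := by
    rw [hw]
    have h := congrArg (at234 X) (braid_first_to_back X' (W ≫ (β_ K K).inv))
    simp only [← at234_comp, at234_whiskerRight, at234_at23] at h
    rw [hG, h, Category.assoc]
  have h13 (S : K ⊗ X' ⟶ K ⊗ X') : at234 X (leg13Over K S) =
      at23 (X ⊗ K) (β_ X' K).inv ≫ at23 X S ▷ K ≫ at23 (X ⊗ K) (β_ X' K).hom := by
    rw [leg13Over_eq_conj_right]
    simp only [← at234_comp, at234_whiskerRight, at234_at23]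
  have hGY : q ▷ K ≫ G = G ≫ Y := by
    have hU := whiskerRight_at23_exchange U (β_ X' K).hom
    have hU' := whiskerRight_at23_exchange U' (β_ X' K).hom
    rw [hq, hG, hY, h13, h13]
    simp only [comp_whiskerRight, Category.assoc]
    rw [reassoc_of% (at23_braid_hom_inv (X ⊗ K) X' K), ← reassoc_of% hU,
      reassoc_of% (at23_braid_hom_inv (X ⊗ K) X' K), ← hU']
    simp only [← comp_whiskerRight_assoc, at23_braid_inv_hom, id_whiskerRight, Category.id_comp]
  have hYw : Y ≫ w ▷ X' = w ▷ X' ≫ Y := by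
    have conj (S : X ⊗ K ⟶ X ⊗ K) : at23 X (β_ K K).inv ▷ X' ≫ (S ▷ K) ▷ X' =
        leg13Over K S ▷ X' ≫ at23 X (β_ K K).inv ▷ X' := by
      rw [leg13Over_eq_conj_right, ← comp_whiskerRight, ← comp_whiskerRight]
      simp only [Category.assoc, at23_braid_hom_inv, Category.comp_id]
    have conj' (S : K ⊗ X' ⟶ K ⊗ X') : at23 X (β_ K K).inv ▷ X' ≫ at234 X (leg13Over K S) =
        at23 (X ⊗ K) S ≫ at23 X (β_ K K).inv ▷ X' := by
      rw [leg13Over_eq]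
      simp only [← at234_comp, at234_whiskerRight, at234_at23]
      rw [← comp_whiskerRight_assoc, at23_braid_inv_hom, id_whiskerRight, Category.id_comp]
    have key := commutator_conj (Q := ((X ⊗ K) ⊗ K) ⊗ X') (w := at23 X W ▷ X')
      (u := (U ▷ K) ▷ X') (u' := (U' ▷ K) ▷ X') (u₁₃ := leg13Over K U ▷ X')
      (u₁₃' := leg13Over K U' ▷ X') (v := at23 (X ⊗ K) V) (v' := at23 (X ⊗ K) V')
      (v₂₄ := at234 X (leg13Over K V)) (v₂₄' := at234 X (leg13Over K V'))
      (by simp only [← comp_whiskerRight, ← leg23_eq_at23, corep])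
      (by
        have h := congrArg (at234 X) rep
        simpa only [← at234_comp, at234_whiskerRight, leg23_eq_at23, at234_at23] using h)
      (whiskerRight_at23_exchange U V)
      (by simp only [← comp_whiskerRight, UU', id_whiskerRight])
      (by simp only [← comp_whiskerRight, U'U, id_whiskerRight])
      (by
        rw [leg13Over_eq, leg13Over_eq, ← comp_whiskerRight]
        simp only [Category.assoc, inv_hom_whiskerRight_assoc]
        rw [← Category.assoc (at23 K U), at23_comp, UU', at23_id]
        simp)
      (by rw [at23_comp, VV', at23_id]) (by rw [at23_comp, V'V, at23_id])
      (by
        rw [leg13Over_eq, leg13Over_eq, at234_comp]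
        simp only [Category.assoc, inv_hom_whiskerRight_assoc]
        rw [← Category.assoc (at23 K V'), at23_comp, V'V, at23_id]
        simp [at234, at23])
    rw [hw, ← at23_comp, comp_whiskerRight, hY]
    simp only [Category.assoc]
    rw [reassoc_of% (conj' V'), reassoc_of% (conj U), reassoc_of% (conj' V), conj U',
      reassoc_of% key]
  have : IsIso G := by rw [hG]; infer_instance
  rw [← cancel_mono G, Category.assoc, hGw, reassoc_of% hGY, hYw, Category.assoc, hGY,
    reassoc_of% hGw]

/-- The braiding of two tensor products, as four crossings of single strands. -/
theorem braid_tensor_inv (A B A' B' : C) :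
    (β_ (A ⊗ B) (A' ⊗ B')).inv = (α_ (A' ⊗ B') A B).inv ≫ (at23 A' (β_ A B').inv ▷ B ≫
      at23 (A' ⊗ A) (β_ B B').inv ≫ ((β_ A A').inv ▷ B) ▷ B' ≫ at23 A (β_ B A').inv ▷ B') ≫
        (α_ (A ⊗ B) A' B').hom := by
  simp only [BraidedCategory.braiding_tensor_left_inv, BraidedCategory.braiding_tensor_right_inv,
    at23]
  monoidal

/-- On `L ⊗ K ⊗ L`: the last three legs of the semi-direct product, followed by the braidings that
bring the first leg to the back, in terms of the operator `p = Φ⁻¹ F` on the first two legs. -/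
theorem semidirect_strands {L : C} {U U' : L ⊗ K ⟶ L ⊗ K} {V V' : K ⊗ L ⟶ K ⊗ L}
    (U'U : U' ≫ U = 𝟙 _) (VV' : V ≫ V' = 𝟙 _)
    (F : L ⊗ L ⟶ L ⊗ L) {q : (L ⊗ L) ⊗ K ⟶ (L ⊗ L) ⊗ K}
    (hq : q = at23 L (β_ L K).hom ≫ (at23 L V' ≫ U ▷ L ≫ at23 L V ≫ U' ▷ L) ≫
      at23 L (β_ L K).inv) :
    at23 L V ≫ leg13Over K F ≫ at23 L V' ≫ (U ≫ (β_ K L).inv) ▷ L ≫ at23 K (β_ L L).inv =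
      at23 L (V ≫ (β_ L K).inv) ≫ (F ▷ K ≫ q ≫ (β_ L L).inv ▷ K) ≫
        at23 L (U ≫ (β_ K L).inv) ≫ ((β_ L K).hom ≫ V') ▷ L := by
  have h1 : at23 L (β_ L K).inv ≫ (β_ L L).inv ▷ K ≫ at23 L (U ≫ (β_ K L).inv) ≫
      (β_ L K).hom ▷ L = (U ≫ (β_ K L).inv) ▷ L ≫ at23 K (β_ L L).inv := by
    have h := braid_first_to_back L (U ≫ (β_ K L).inv)
    rw [← cancel_mono (at23 K (β_ L L).hom)]
    simp only [Category.assoc, h, at23_braid_inv_hom, Category.comp_id]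
    rw [inv_hom_whiskerRight_assoc, reassoc_of% (at23_braid_inv_hom L L K)]
  have h2 := braid_inv_first_to_back L V
  have hVV : at23 L V ≫ at23 L V' = 𝟙 _ := by rw [at23_comp, VV', at23_id]
  have h3 : U' ▷ L ≫ U ▷ L = 𝟙 _ := by rw [← comp_whiskerRight, U'U, id_whiskerRight]
  have h4 : V ▷ L ≫ V' ▷ L = 𝟙 _ := by rw [← comp_whiskerRight, VV', id_whiskerRight]
  rw [hq, leg13Over_eq_conj_right, comp_whiskerRight (β_ L K).hom, ← at23_comp L V]
  simp only [Category.assoc]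
  rw [reassoc_of% h1, comp_whiskerRight]
  simp only [Category.assoc]
  rw [reassoc_of% h3, reassoc_of% h2, h4, Category.comp_id]

end Identities

noncomputable section

open InnerProductSpace ContinuousLinearMap

variable {C : Type u} [Category.{v} C] [Preadditive C] [Linear ℂ C] [MonoidalCategory C]
  [MonoidalPreadditive C] [MonoidalLinear ℂ C] [MonoidalWStarCategory C]

namespace FibreFunctor

variable (Fib : FibreFunctor.{v, u, w} C)

/-! ### Adjoints -/

theorem amp_adjoint {A B : C} (T : Fib.obj A →L[ℂ] Fib.obj B) (Z : C) :
    adjoint (Fib.amp T Z) = Fib.amp (adjoint T) Z := by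
  refine hom_ext_ket fun z => ?_
  have h := congrArg adjoint (Fib.bra_amp T Z z)
  simpa [adjoint_comp, bra, amp_ket] using h

theorem map_assoc_inv_adjoint (X Y Z : C) :
    adjoint (Fib.map (α_ X Y Z).inv) = Fib.map (α_ X Y Z).hom := by
  refine hom_ext_ket fun z => hom_ext_ket fun y => ?_
  have h := congrArg adjoint (Fib.bra_bra_map_assoc_inv X y z)
  simp only [adjoint_comp, bra, adjoint_adjoint] at h
  rw [ContinuousLinearMap.comp_assoc, ContinuousLinearMap.comp_assoc, map_assoc_ket_ket, ← h,
    ContinuousLinearMap.comp_assoc]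

theorem map_assoc_hom_adjoint (X Y Z : C) :
    adjoint (Fib.map (α_ X Y Z).hom) = Fib.map (α_ X Y Z).inv := by
  rw [← map_assoc_inv_adjoint, adjoint_adjoint]

theorem map_at23_adjoint (A : C) {B D B' D' : C} (T : B ⊗ D ⟶ B' ⊗ D') :
    adjoint (Fib.map (at23 A T)) = Fib.map (at23 A (CStarCategory.adj T)) := by
  simp only [at23, map_comp, adjoint_comp, map_assoc_hom_adjoint, map_assoc_inv_adjoint,
    ContinuousLinearMap.comp_assoc]
  rw [← Fib.map_adj, MonoidalWStarCategory.adj_whiskerLeft]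

theorem map_whiskerRight_adjoint {B D : C} (T : B ⟶ D) (A : C) :
    adjoint (Fib.map (T ▷ A)) = Fib.map (CStarCategory.adj T ▷ A) := by
  rw [← Fib.map_adj, MonoidalWStarCategory.adj_whiskerRight]

theorem map_at23 (A : C) {B D B' D' : C} (T : B ⊗ D ⟶ B' ⊗ D') :
    Fib.map (at23 A T) = Fib.map (α_ A B' D').inv ∘L Fib.lamp A (Fib.map T) ∘L
      Fib.map (α_ A B D).hom := by
  rw [at23, map_comp, map_comp, lamp_map, ContinuousLinearMap.comp_assoc]

theorem bra_map_at23_ket (A : C) {Y Z Y' Z' : C} (T : Y ⊗ Z ⟶ Y' ⊗ Z') (z : Fib.obj Z)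
    (z' : Fib.obj Z') :
    Fib.bra (A ⊗ Y') z' ∘L Fib.map (at23 A T) ∘L Fib.ket (A ⊗ Y) z =
      Fib.lamp A (Fib.bra Y' z' ∘L Fib.map T ∘L Fib.ket Y z) := by
  rw [map_at23, bra_lamp_ket]

theorem bra_comp_ket_adjoint {X Y X' Y' : C} (T : Fib.obj (X ⊗ Y) →L[ℂ] Fib.obj (X' ⊗ Y'))
    (y : Fib.obj Y) (y' : Fib.obj Y') :
    adjoint (Fib.bra X' y' ∘L T ∘L Fib.ket X y) = Fib.bra X y ∘L adjoint T ∘L Fib.ket X' y' := by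
  simp only [adjoint_comp, bra, adjoint_adjoint, ContinuousLinearMap.comp_assoc]

theorem map_comp_apply {X Y Z : C} (f : X ⟶ Y) (g : Y ⟶ Z) (x : Fib.obj X) :
    Fib.map (f ≫ g) x = Fib.map g (Fib.map f x) := by
  rw [map_comp, ContinuousLinearMap.comp_apply]

theorem bra_map_whiskerRight_apply {X X' : C} (f : X ⟶ X') (Y : C) (y : Fib.obj Y)
    (z : Fib.obj (X ⊗ Y)) : Fib.bra X' y (Fib.map (f ▷ Y) z) = Fib.map f (Fib.bra X y z) :=
  DFunLike.congr_fun (Fib.bra_map_whiskerRight f Y y) z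

theorem map_whiskerRight_ket_apply {X X' : C} (f : X ⟶ X') (Y : C) (y : Fib.obj Y)
    (x : Fib.obj X) : Fib.map (f ▷ Y) (Fib.ket X y x) = Fib.ket X' y (Fib.map f x) :=
  DFunLike.congr_fun (Fib.map_whiskerRight_ket f Y y) x

theorem map_whiskerLeft_ket_apply (X : C) {Y Y' : C} (g : Y ⟶ Y') (y : Fib.obj Y)
    (x : Fib.obj X) : Fib.map (X ◁ g) (Fib.ket X y x) = Fib.ket X (Fib.map g y) x :=
  Fib.μ_natural_right X g x y

theorem map_assoc_inv_ket_apply (X : C) {Y Z : C} (y : Fib.obj Y) (z : Fib.obj Z)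
    (x : Fib.obj X) : Fib.map (α_ X Y Z).inv (Fib.ket X (Fib.μ Y Z (y ⊗ₜ[ℂ] z)) x) =
      Fib.ket (X ⊗ Y) z (Fib.ket X y x) :=
  Fib.map_assoc_inv_tmul x y z

theorem map_assoc_ket_ket_apply (X : C) {Y Z : C} (y : Fib.obj Y) (z : Fib.obj Z)
    (x : Fib.obj X) : Fib.map (α_ X Y Z).hom (Fib.ket (X ⊗ Y) z (Fib.ket X y x)) =
      Fib.ket X (Fib.μ Y Z (y ⊗ₜ[ℂ] z)) x :=
  Fib.μ_assoc X Y Z x y z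

theorem map_at23_ket_ket_apply (A : C) {Y Z Y' Z' : C} (T : Y ⊗ Z ⟶ Y' ⊗ Z') (y : Fib.obj Y)
    (z : Fib.obj Z) (x : Fib.obj A) :
    Fib.map (at23 A T) (Fib.ket (A ⊗ Y) z (Fib.ket A y x)) =
      Fib.map (α_ A Y' Z').inv (Fib.ket A (Fib.map T (Fib.μ Y Z (y ⊗ₜ[ℂ] z))) x) := by
  rw [at23, map_comp_apply, map_comp_apply, map_assoc_ket_ket_apply, map_whiskerLeft_ket_apply]

theorem amp_ket_apply {A B : C} (T : Fib.obj A →L[ℂ] Fib.obj B) (Z : C) (z : Fib.obj Z)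
    (a : Fib.obj A) : Fib.amp T Z (Fib.ket A z a) = Fib.ket B z (T a) :=
  Fib.amp_tmul T Z a z

theorem bra_map_whiskerLeft_apply (X : C) {Y Y' : C} (g : Y ⟶ Y') (y : Fib.obj Y')
    (z : Fib.obj (X ⊗ Y)) :
    Fib.bra X y (Fib.map (X ◁ g) z) = Fib.bra X (Fib.map (CStarCategory.adj g) y) z := by
  rw [map_adj]
  exact DFunLike.congr_fun (Fib.bra_map_whiskerLeft X g y) z

theorem bra_bra_map_assoc_inv_apply (X : C) {Y Z : C} (y : Fib.obj Y) (z : Fib.obj Z)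
    (u : Fib.obj (X ⊗ (Y ⊗ Z))) :
    Fib.bra X y (Fib.bra (X ⊗ Y) z (Fib.map (α_ X Y Z).inv u)) =
      Fib.bra X (Fib.μ Y Z (y ⊗ₜ[ℂ] z)) u :=
  DFunLike.congr_fun (Fib.bra_bra_map_assoc_inv X y z) u

theorem bra_map_at23_ket_apply (A : C) {Y Z Y' Z' : C} (T : Y ⊗ Z ⟶ Y' ⊗ Z') (z : Fib.obj Z)
    (z' : Fib.obj Z') (u : Fib.obj (A ⊗ Y)) :
    Fib.bra (A ⊗ Y') z' (Fib.map (at23 A T) (Fib.ket (A ⊗ Y) z u)) =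
      Fib.lamp A (Fib.bra Y' z' ∘L Fib.map T ∘L Fib.ket Y z) u :=
  DFunLike.congr_fun (Fib.bra_map_at23_ket A T z z') u

theorem lamp_ket_apply (A : C) {B B' : C} (T : Fib.obj B →L[ℂ] Fib.obj B') (b : Fib.obj B)
    (a : Fib.obj A) : Fib.lamp A T (Fib.ket A b a) = Fib.ket A (T b) a :=
  Fib.lamp_tmul A T a b

theorem map_surjective_of_comp_eq_id {X Y : C} {f : X ⟶ Y} {g : Y ⟶ X} (h : g ≫ f = 𝟙 Y) :
    Function.Surjective (Fib.map f) := fun y => ⟨Fib.map g y, by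
  have := Fib.map_comp g f
  rw [h, Fib.map_id] at this
  exact (congrArg (fun T : Fib.obj Y →L[ℂ] Fib.obj Y => T y) this).symm⟩

/-- Contracting the second leg of a total family of vectors with all vectors gives a total
family. -/
theorem closedSpan_bra {X Y : C} {ι : Type*} {u : ι → Fib.obj (X ⊗ Y)} (hu : closedSpan u = ⊤)
    [Nontrivial (Fib.obj Y)] :
    closedSpan (fun p : Fib.obj Y × ι => Fib.bra X p.1 (u p.2)) = ⊤ := by
  rw [closedSpan_congr (fun y => Fib.bra X y) (hu.trans closedSpan_id.symm)]
  refine eq_top_iff.2 fun x _ => ?_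
  obtain ⟨y, hy⟩ := exists_ne (0 : Fib.obj Y)
  have h := Submodule.smul_mem _ (⟪y, y⟫_ℂ)⁻¹ (mem_closedSpan
    (fun p : Fib.obj Y × Fib.obj (X ⊗ Y) => Fib.bra X p.1 p.2) (y, Fib.μ X Y (x ⊗ₜ[ℂ] y)))
  rwa [bra_tmul, smul_smul, inv_mul_cancel₀ (inner_self_ne_zero.2 hy), one_smul] at h

/-- The slices of the adjoint are the adjoints of the slices. -/
theorem slices_adjoint_eq_compacts {X Y X' Y' : C}
    {T : Fib.obj (X ⊗ Y) →L[ℂ] Fib.obj (X' ⊗ Y')} (h : Fib.slices T = Fib.compacts X X') :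
    Fib.slices (adjoint T) = Fib.compacts X' X := by
  rw [slices_eq_closedSpan, compacts, compactOperator_eq_closedSpan_rankOne] at h
  rw [slices_eq_closedSpan, compacts, compactOperator_eq_closedSpan_rankOne]
  refine closedSpan_exchange h (fun _ : Unit => (adjoint (𝕜 := ℂ) (E := Fib.obj X)
    (F := Fib.obj X')).toContinuousLinearEquiv.toContinuousLinearMap)
    (fun p => ((), p.swap)) (fun p => ((), p.swap)) (fun p => ⟨p.2.swap, rfl⟩)
    (fun p => ⟨p.2.swap, rfl⟩) (fun p => ?_) (fun p => ?_)
  · exact (Fib.bra_comp_ket_adjoint T p.2 p.1).symm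
  · exact (adjoint_rankOne p.2 p.1).symm

end FibreFunctor

/-- An operator commuting with the compact operators on the last leg acts only on the other
ones. -/
theorem exists_amp_eq {Fib : FibreFunctor.{v, u, w} C} {X K : C} (hK : Nontrivial (Fib.obj K))
    {Q : Fib.obj (X ⊗ K) →L[ℂ] Fib.obj (X ⊗ K)}
    (hQ : ∀ a b : Fib.obj K, Q ∘L Fib.lamp X (rankOne ℂ a b) =
      Fib.lamp X (rankOne ℂ a b) ∘L Q) :
    ∃ Z : Fib.obj X →L[ℂ] Fib.obj X, Fib.amp Z K = Q := by
  obtain ⟨k, hk⟩ := exists_ne (0 : Fib.obj K)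
  have hk' : ⟪k, k⟫_ℂ ≠ 0 := inner_self_ne_zero.2 hk
  refine ⟨(⟪k, k⟫_ℂ)⁻¹ • (Fib.bra X k ∘L Q ∘L Fib.ket X k), FibreFunctor.hom_ext fun x y => ?_⟩
  have h := DFunLike.congr_fun (hQ y k) (Fib.μ X K (x ⊗ₜ[ℂ] k))
  simp only [ContinuousLinearMap.comp_apply, Fib.lamp_rankOne, Fib.bra_tmul, map_smul] at h
  rw [Fib.amp_tmul, smul_apply, ← TensorProduct.smul_tmul', LinearIsometry.map_smul,
    inv_smul_eq_iff₀ hk']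
  exact h.symm

theorem adj_eq_inv_of_isUnitary {X Y : C} {e : X ≅ Y} (h : IsUnitary e.hom) :
    CStarCategory.adj e.hom = e.inv := by
  rw [← cancel_epi e.hom, h.1, e.hom_inv_id]

theorem adj_inv_eq_of_isUnitary {X Y : C} {e : X ≅ Y} (h : IsUnitary e.hom) :
    CStarCategory.adj e.inv = e.hom := by
  rw [← adj_eq_inv_of_isUnitary h, CStarCategory.adj_adj]

variable [BraidedCategory C] {Fib : FibreFunctor.{v, u, w} C}

theorem slices_braid_inv (hc : IsRegularBraiding Fib) (X Y : C) :
    Fib.slices (Fib.map (β_ X Y).inv) = Fib.compacts Y X := by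
  rw [← adj_eq_inv_of_isUnitary (hc.1 X Y), Fib.map_adj]
  exact Fib.slices_adjoint_eq_compacts (hc.2 X Y)

/-! ### Regularity of corepresentations -/

section

variable {K X X' : C} {W : K ⊗ K ⟶ K ⊗ K}

/-- The slices of `c⁻¹ W` by vector functionals. -/
theorem IsRegular.closedSpan_slices (hW : IsRegular Fib W) :
    closedSpan (fun p : Fib.obj K × Fib.obj K =>
      Fib.bra K p.2 ∘L Fib.map (W ≫ (β_ K K).inv) ∘L Fib.ket K p.1) =
    closedSpan (fun p : Fib.obj K × Fib.obj K => rankOne ℂ p.1 p.2) := by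
  have h := hW
  rwa [IsRegular, FibreFunctor.slices_eq_closedSpan, FibreFunctor.compacts,
    compactOperator_eq_closedSpan_rankOne] at h

/-- Regularity passes from `W` to its corepresentations `U`: the slices of `c⁻¹ U` span the
compact operators. By the corepresentation property, `U` may be traded for `c⁻¹ W` on the last two
legs, up to unitaries that are absorbed by the functionals. -/
theorem slices_corep (hc : IsRegularBraiding Fib) (hW : IsRegular Fib W)
    {U : X ⊗ K ⟶ X ⊗ K} (hU : IsUnitary U)
    (corep : U ▷ K ≫ leg23 X W = leg23 X W ≫ leg13Over K U ≫ U ▷ K) :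
    Fib.slices (Fib.map (U ≫ (β_ K X).inv)) = Fib.compacts X K := by
  rcases subsingleton_or_nontrivial (Fib.obj K) with hK | hK
  · exact Subsingleton.elim _ _
  set s : Fib.obj K × Fib.obj K → (Fib.obj K →L[ℂ] Fib.obj K) := fun p =>
    Fib.bra K p.2 ∘L Fib.map (W ≫ (β_ K K).inv) ∘L Fib.ket K p.1 with hs
  have hreg : closedSpan s = _ := hW.closedSpan_slices
  have htot : closedSpan (fun p : Fib.obj K × (Fib.obj K × Fib.obj K) => s p.2 p.1) = ⊤ := by
    refine (closedSpan_congr (fun k : Fib.obj K => ContinuousLinearMap.apply ℂ (Fib.obj K) k)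
      hreg).trans ?_
    refine eq_top_iff.2 fun a _ => ?_
    obtain ⟨k, hk⟩ := exists_ne (0 : Fib.obj K)
    have h := Submodule.smul_mem _ (⟪k, k⟫_ℂ)⁻¹ (mem_closedSpan
      (fun p : Fib.obj K × (Fib.obj K × Fib.obj K) =>
        ContinuousLinearMap.apply ℂ (Fib.obj K) p.1 (rankOne ℂ p.2.1 p.2.2)) (k, (a, k)))
    have hk' : ⟪k, k⟫_ℂ ≠ 0 := inner_self_ne_zero.2 hk
    rwa [apply_apply, rankOne_apply, smul_smul, inv_mul_cancel₀ hk', one_smul] at h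
  have hUtot : closedSpan (fun p : Fib.obj X × Fib.obj K =>
      Fib.map U (Fib.μ X K (p.1 ⊗ₜ[ℂ] p.2))) = ⊤ :=
    closedSpan_map_of_surjective (Fib.closedSpan_tmul X K) (Fib.map U)
      (Fib.map_surjective_of_comp_eq_id hU.2)
  have hU'tot : closedSpan (fun p : Fib.obj X × Fib.obj K =>
      Fib.map (CStarCategory.adj U) (Fib.μ X K (p.1 ⊗ₜ[ℂ] p.2))) = ⊤ :=
    closedSpan_map_of_surjective (Fib.closedSpan_tmul X K) (Fib.map (CStarCategory.adj U))
      (Fib.map_surjective_of_comp_eq_id hU.1)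
  set r := U ▷ K ≫ at23 X (W ≫ (β_ K K).inv) ≫ (β_ K X).inv ▷ K with hr
  have hident : at23 X (W ≫ (β_ K K).inv) ≫ (U ≫ (β_ K X).inv) ▷ K =
      r ≫ at23 K (CStarCategory.adj U) := by
    rw [hr, ← corep_braid_inv corep]
    simp only [Category.assoc]
    rw [at23_comp, hU.1, at23_id, Category.comp_id]
  -- The generators after trading `U` for `U'₂₃`.
  have e1 (k : Fib.obj K) (p : Fib.obj K × Fib.obj K) (x : Fib.obj X) :
      Fib.bra K x ∘L Fib.map (U ≫ (β_ K X).inv) ∘L Fib.ket X (s p k) =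
      Fib.bra K (Fib.map U (Fib.μ X K (x ⊗ₜ[ℂ] p.2))) ∘L
        (Fib.map (α_ K X K).hom ∘L Fib.map r ∘L Fib.ket (X ⊗ K) p.1 ∘L Fib.ket X k) := by
    ext v
    simp only [ContinuousLinearMap.comp_apply]
    rw [← Fib.lamp_ket_apply, hs, ← Fib.bra_map_at23_ket_apply, ← Fib.bra_map_whiskerRight_apply,
      ← Fib.map_comp_apply, hident, Fib.map_comp_apply, at23, Fib.map_comp_apply,
      Fib.map_comp_apply, Fib.bra_bra_map_assoc_inv_apply, Fib.bra_map_whiskerLeft_apply,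
      CStarCategory.adj_adj]
  have e2 (k : Fib.obj K) (p : Fib.obj K × Fib.obj K) (x : Fib.obj X) :
      Fib.bra K (Fib.μ X K (x ⊗ₜ[ℂ] p.2)) ∘L
        (Fib.map (α_ K X K).hom ∘L Fib.map r ∘L Fib.ket (X ⊗ K) p.1 ∘L Fib.ket X k) =
      Fib.bra K x ∘L Fib.map (β_ K X).inv ∘L Fib.lamp X (s p) ∘L Fib.map U ∘L Fib.ket X k := by
    ext v
    simp only [ContinuousLinearMap.comp_apply]
    rw [← Fib.bra_bra_map_assoc_inv_apply, Fib.map_hom_inv_apply, hr, Fib.map_comp_apply,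
      Fib.map_whiskerRight_ket_apply, Fib.map_comp_apply, Fib.bra_map_whiskerRight_apply,
      Fib.bra_map_at23_ket_apply]
  rw [Fib.slices_eq_closedSpan_of_total _ htot closedSpan_id]
  have step1 := closedSpan_exchange (hUtot.trans (Fib.closedSpan_tmul X K).symm)
    (fun q : Fib.obj K × Fib.obj K => ((compL ℂ _ _ _).flip
      (Fib.map (α_ K X K).hom ∘L Fib.map r ∘L Fib.ket (X ⊗ K) q.2 ∘L Fib.ket X q.1)).comp
        (Fib.braL K (X ⊗ K)))
    (g := fun p : (Fib.obj K × (Fib.obj K × Fib.obj K)) × Fib.obj X =>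
      Fib.bra K p.2 ∘L Fib.map (U ≫ (β_ K X).inv) ∘L Fib.ket X (s p.1.2 p.1.1))
    (g' := fun p : (Fib.obj K × (Fib.obj K × Fib.obj K)) × Fib.obj X =>
      Fib.bra K p.2 ∘L Fib.map (β_ K X).inv ∘L Fib.lamp X (s p.1.2) ∘L Fib.map U ∘L
        Fib.ket X p.1.1)
    (fun p => ((p.1.1, p.1.2.1), (p.2, p.1.2.2))) (fun p => ((p.1.1, p.1.2.1), (p.2, p.1.2.2)))
    (fun p => ⟨((p.1.1, (p.1.2, p.2.2)), p.2.1), rfl⟩)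
    (fun p => ⟨((p.1.1, (p.1.2, p.2.2)), p.2.1), rfl⟩)
    (fun p => e1 p.1.1 p.1.2 p.2) (fun p => (e2 p.1.1 p.1.2 p.2).symm)
  have step2 := closedSpan_exchange hreg
    (fun q : Fib.obj K × Fib.obj X => (compL ℂ _ _ _ (Fib.bra K q.2 ∘L Fib.map (β_ K X).inv)).comp
      (((compL ℂ _ _ _).flip (Fib.map U ∘L Fib.ket X q.1)).comp (Fib.lamp X)))
    (g := fun p : (Fib.obj K × (Fib.obj K × Fib.obj K)) × Fib.obj X =>
      Fib.bra K p.2 ∘L Fib.map (β_ K X).inv ∘L Fib.lamp X (s p.1.2) ∘L Fib.map U ∘L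
        Fib.ket X p.1.1)
    (g' := fun p : (Fib.obj K × Fib.obj K) × (Fib.obj K × Fib.obj X) =>
      (Fib.bra K p.2.2 ∘L Fib.map (β_ K X).inv ∘L Fib.ket X p.2.1) ∘L
        (Fib.bra X p.1.2 ∘L Fib.map U ∘L Fib.ket X p.1.1))
    (fun p => ((p.1.1, p.2), p.1.2)) (fun p => ((p.1.1, p.2.2), (p.2.1, p.1.2)))
    (fun p => ⟨((p.1.1, p.2), p.1.2), rfl⟩) (fun p => ⟨((p.1.1, p.2.2), (p.2.1, p.1.2)), rfl⟩)
    (fun p => rfl) (fun p => by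
      simp only [ContinuousLinearMap.comp_apply, compL_apply, flip_apply, Fib.lamp_rankOne,
        ContinuousLinearMap.comp_assoc])
  have hβ := slices_braid_inv hc K X
  rw [Fib.slices_eq_closedSpan, FibreFunctor.compacts,
    compactOperator_eq_closedSpan_rankOne] at hβ
  have step3 := closedSpan_exchange hβ
    (fun q : Fib.obj K × Fib.obj K => (compL ℂ _ _ _).flip
      (Fib.bra X q.2 ∘L Fib.map U ∘L Fib.ket X q.1))
    (g := fun p : (Fib.obj K × Fib.obj K) × (Fib.obj K × Fib.obj X) =>
      (Fib.bra K p.2.2 ∘L Fib.map (β_ K X).inv ∘L Fib.ket X p.2.1) ∘L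
        (Fib.bra X p.1.2 ∘L Fib.map U ∘L Fib.ket X p.1.1))
    (g' := fun p : Fib.obj K × (Fib.obj K × (Fib.obj X × Fib.obj K)) =>
      rankOne ℂ p.1 (Fib.bra X p.2.1
        (Fib.map (CStarCategory.adj U) (Fib.μ X K (p.2.2.1 ⊗ₜ[ℂ] p.2.2.2)))))
    id (fun p => ((p.2.1, p.2.2.2), (p.1, p.2.2.1)))
    Function.surjective_id (fun p => ⟨(p.2.1, (p.1.1, (p.2.2, p.1.2))), rfl⟩)
    (fun p => rfl) (fun p => by
      simp only [flip_apply, compL_apply, rankOne_comp, Fib.bra_comp_ket_adjoint, ← Fib.map_adj]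
      rfl)
  rw [step1, step2, step3, FibreFunctor.compacts]
  exact (compactOperator_eq_closedSpan_rankOne_of_total closedSpan_id
    (Fib.closedSpan_bra hU'tot)).symm

/-! ### Existence of the product of a representation and a corepresentation -/

theorem starTriple'_eq (U : X ⊗ K ⟶ X ⊗ K) (V : K ⊗ X' ⟶ K ⊗ X') :
    starTriple' U V = at23 X (β_ X' K).hom ≫ (at23 X (CStarCategory.adj V) ≫ U ▷ X' ≫ at23 X V ≫
      CStarCategory.adj U ▷ X') ≫ at23 X (β_ X' K).inv := rfl

theorem map_starTriple'_mem_unitary (hc : IsRegularBraiding Fib) {U : X ⊗ K ⟶ X ⊗ K}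
    {V : K ⊗ X' ⟶ K ⊗ X'} (hU : IsUnitary U) (hV : IsUnitary V) :
    Fib.map (starTriple' U V) ∈
      unitary (Fib.obj ((X ⊗ X') ⊗ K) →L[ℂ] Fib.obj ((X ⊗ X') ⊗ K)) := by
  have hadj : adjoint (Fib.map (starTriple' U V)) = Fib.map (at23 X (β_ X' K).hom ≫
      (U ▷ X' ≫ at23 X (CStarCategory.adj V) ≫ CStarCategory.adj U ▷ X' ≫ at23 X V) ≫
        at23 X (β_ X' K).inv) := by
    rw [starTriple'_eq]
    simp only [Fib.map_comp, adjoint_comp, Fib.map_at23_adjoint, Fib.map_whiskerRight_adjoint,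
      adj_eq_inv_of_isUnitary (hc.1 X' K), adj_inv_eq_of_isUnitary (hc.1 X' K),
      CStarCategory.adj_adj, ContinuousLinearMap.comp_assoc]
  have hVV : at23 X V ≫ at23 X (CStarCategory.adj V) = 𝟙 _ := by rw [at23_comp, hV.1, at23_id]
  have hV'V : at23 X (CStarCategory.adj V) ≫ at23 X V = 𝟙 _ := by rw [at23_comp, hV.2, at23_id]
  have hUU : U ▷ X' ≫ CStarCategory.adj U ▷ X' = 𝟙 _ := by
    rw [← comp_whiskerRight, hU.1, id_whiskerRight]
  have hU'U : CStarCategory.adj U ▷ X' ≫ U ▷ X' = 𝟙 _ := by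
    rw [← comp_whiskerRight, hU.2, id_whiskerRight]
  rw [Unitary.mem_iff, star_eq_adjoint, hadj, starTriple'_eq, mul_def, mul_def, ← Fib.map_comp,
    ← Fib.map_comp]
  simp only [Category.assoc]
  rw [reassoc_of% (at23_braid_inv_hom X X' K), reassoc_of% hU'U, reassoc_of% hVV,
    reassoc_of% hUU, reassoc_of% hV'V, at23_braid_hom_inv, Fib.map_id,
    reassoc_of% (at23_braid_inv_hom X X' K), reassoc_of% hVV, reassoc_of% hU'U,
    reassoc_of% hV'V, reassoc_of% hUU, at23_braid_hom_inv, Fib.map_id]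
  exact ⟨rfl, rfl⟩

/-- The product `V ∗ U` exists over a regular `W`: the commutator of `U` and `V` commutes with the
slices of `c⁻¹ W`, hence with all compact operators, on the last leg. -/
theorem exists_isStarProduct (hc : IsRegularBraiding Fib) (hW : IsRegular Fib W)
    {U : X ⊗ K ⟶ X ⊗ K} {V : K ⊗ X' ⟶ K ⊗ X'} (hU : IsUnitary U) (hV : IsUnitary V)
    (corep : U ▷ K ≫ leg23 X W = leg23 X W ≫ leg13Over K U ≫ U ▷ K)
    (rep : W ▷ X' ≫ leg23 K V = leg23 K V ≫ leg13Over K V ≫ W ▷ X') :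
    ∃ Z, IsStarProduct Fib U V Z := by
  rcases subsingleton_or_nontrivial (Fib.obj K) with hK | hK
  · refine ⟨1, one_mem _, FibreFunctor.hom_ext fun x y => ?_⟩
    rw [Subsingleton.elim y 0, TensorProduct.tmul_zero, LinearIsometry.map_zero, map_zero, map_zero]
  have hcomm := commutator_comm_braid_inv corep rep hU.1 hU.2 hV.1 hV.2 (starTriple'_eq U V)
  have hQ := map_starTriple'_mem_unitary hc hU hV
  set q := starTriple' U V
  obtain ⟨Z, hZ⟩ := exists_amp_eq hK (Q := Fib.map q) fun a b => by
    have hmem : rankOne ℂ a b ∈ closedSpan (fun p : Fib.obj K × Fib.obj K =>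
        Fib.bra K p.2 ∘L Fib.map (W ≫ (β_ K K).inv) ∘L Fib.ket K p.1) := by
      rw [hW.closedSpan_slices]
      exact mem_closedSpan (fun p : Fib.obj K × Fib.obj K => rankOne ℂ p.1 p.2) (a, b)
    have := map_mem_of_mem_closedSpan ((compL ℂ _ _ _ (Fib.map q) -
      (compL ℂ _ _ _).flip (Fib.map q)).comp (Fib.lamp (X ⊗ X'))) (M := ⊥) isClosed_singleton
      (fun p => ?_) hmem
    · simpa [sub_eq_zero] using this
    · rw [Submodule.mem_bot, ContinuousLinearMap.comp_apply, sub_apply, sub_eq_zero, flip_apply,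
        compL_apply, compL_apply]
      ext v
      rw [ContinuousLinearMap.comp_apply, ContinuousLinearMap.comp_apply,
        ← Fib.bra_map_at23_ket_apply, ← Fib.bra_map_at23_ket_apply,
        ← Fib.bra_map_whiskerRight_apply, ← Fib.map_whiskerRight_ket_apply, ← Fib.map_comp_apply,
        ← Fib.map_comp_apply, hcomm]
  have inj {S : Fib.obj (X ⊗ X') →L[ℂ] Fib.obj (X ⊗ X')} (h : Fib.amp S K = 1) : S = 1 := by
    obtain ⟨k, hk⟩ := exists_ne (0 : Fib.obj K)
    have hk' : ⟪k, k⟫_ℂ ≠ 0 := inner_self_ne_zero.2 hk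
    have h1 := Fib.bra_amp S K k
    ext x
    have h2 := DFunLike.congr_fun h1 (Fib.μ _ _ (x ⊗ₜ[ℂ] k))
    simp only [h, ContinuousLinearMap.comp_apply, one_apply_eq_self, Fib.bra_tmul, map_smul] at h2
    exact (smul_right_injective _ hk' h2).symm
  refine ⟨Z, ?_, hZ⟩
  rw [← hZ, Unitary.mem_iff, star_eq_adjoint, Fib.amp_adjoint, mul_def, mul_def,
    ← Fib.amp_comp, ← Fib.amp_comp] at hQ
  exact ⟨inj hQ.1, inj hQ.2⟩

end

end

noncomputable section

open InnerProductSpace ContinuousLinearMap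

variable {C : Type u} [Category.{v} C] [Preadditive C] [Linear ℂ C] [MonoidalCategory C]
  [MonoidalPreadditive C] [MonoidalLinear ℂ C] [MonoidalWStarCategory C] [BraidedCategory C]
  {Fib : FibreFunctor.{v, u, w} C} {K : C} {W : K ⊗ K ⟶ K ⊗ K}

namespace YetterDrinfeld

/-! ### The semi-direct product in terms of `c⁻¹ W`, `c⁻¹ U` and `Φ⁻¹ F` -/

variable (L : YetterDrinfeld W) (F : L.X ⊗ L.X ⟶ L.X ⊗ L.X)

/-- The operator `c_{L,K}⁻¹ (c⁻¹ W)₁₂ V₂₃* c_{L,K}` on `K ⊗ L ⊗ K`, with the outer braidings on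
the last two legs. -/
def corner : (K ⊗ L.X) ⊗ K ⟶ (K ⊗ L.X) ⊗ K :=
  at23 K ((β_ L.X K).hom ≫ CStarCategory.adj L.V) ≫ (W ≫ (β_ K K).inv) ▷ L.X ≫
    at23 K (β_ L.X K).inv

/-- The operator `Φ⁻¹ F` on the first two legs of `L ⊗ L ⊗ K`, which is a morphism of `C`. -/
def braidInvAmp : (L.X ⊗ L.X) ⊗ K ⟶ (L.X ⊗ L.X) ⊗ K :=
  F ▷ K ≫ starTriple' L.U L.V ≫ (β_ L.X L.X).inv ▷ K

theorem semidirect_eq_strands : L.semidirect F = (α_ (K ⊗ L.X) K L.X).inv ≫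
    (at23 (K ⊗ L.X) L.V ≫ at234 K (leg13Over K F) ≫ at23 (K ⊗ L.X) (CStarCategory.adj L.V) ≫
      at23 K L.U ▷ L.X ≫ leg13Over L.X W ▷ L.X) ≫ (α_ (K ⊗ L.X) K L.X).hom := by
  rw [semidirect, whiskerLeft_assoc_eq_at234, whiskerLeft_assoc_eq_at234, whiskerLeft_eq_at23,
    whiskerLeft_eq_at23, at234_whiskerRight]
  simp only [Category.assoc, Iso.hom_inv_id_assoc]

/-- The factorization of `c⁻¹ (W ⋉ F)`. -/
theorem semidirect_braid_inv : L.semidirect F ≫ (β_ (K ⊗ L.X) (K ⊗ L.X)).inv =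
    (K ⊗ L.X) ◁ (L.V ≫ (β_ L.X K).inv) ≫ (α_ (K ⊗ L.X) L.X K).inv ≫
      at234 K (L.braidInvAmp F) ≫ at23 (K ⊗ L.X) (L.U ≫ (β_ K L.X).inv) ≫ L.corner ▷ L.X ≫
        (α_ (K ⊗ L.X) K L.X).hom := by
  have h := congrArg (at234 K) (semidirect_strands L.unitary_U.2 L.unitary_V.1 F
    (starTriple'_eq L.U L.V))
  simp only [← at234_comp, at234_whiskerRight, at234_at23] at h
  have hW : leg13Over L.X W ≫ at23 K (β_ K L.X).inv = at23 K (β_ K L.X).inv ≫ W ▷ L.X := by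
    rw [leg13Over_eq_conj_right]
    simp only [Category.assoc, at23_braid_hom_inv, Category.comp_id]
  have hW' : leg13Over L.X W ▷ L.X ≫ at23 K (β_ K L.X).inv ▷ L.X =
      at23 K (β_ K L.X).inv ▷ L.X ≫ (W ▷ L.X) ▷ L.X := by
    rw [← comp_whiskerRight, hW, comp_whiskerRight]
  rw [semidirect_eq_strands, braid_tensor_inv]
  simp only [Category.assoc, Iso.hom_inv_id_assoc]
  rw [reassoc_of% hW', reassoc_of% (whiskerRight_at23_exchange W (β_ L.X L.X).inv)]
  rw [← comp_whiskerRight_assoc (at23 K L.U), at23_comp, reassoc_of% h, braidInvAmp, corner]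
  simp only [← at234_comp, at234_whiskerRight, comp_whiskerRight, Category.assoc,
    whiskerLeft_eq_at23, Iso.hom_inv_id_assoc]

end YetterDrinfeld

end

noncomputable section

open InnerProductSpace ContinuousLinearMap

variable {C : Type u} [Category.{v} C] [Preadditive C] [Linear ℂ C] [MonoidalCategory C]
  [MonoidalPreadditive C] [MonoidalLinear ℂ C] [MonoidalWStarCategory C] [BraidedCategory C]
  {Fib : FibreFunctor.{v, u, w} C} {K : C} {W : K ⊗ K ⟶ K ⊗ K}

namespace YetterDrinfeld

variable (L : YetterDrinfeld W) (F : L.X ⊗ L.X ⟶ L.X ⊗ L.X)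

/-- The operator `Φ⁻¹ F` of the Yetter-Drinfeld category. -/
def braidInvComp (Fib : FibreFunctor.{v, u, w} C) :
    Fib.obj (L.X ⊗ L.X) →L[ℂ] Fib.obj (L.X ⊗ L.X) :=
  braidingInv Fib L L ∘L Fib.map F

/-- Existence of `V ∗ U` is what makes the operator `Φ⁻¹ F` genuine, rather than one formed with the
default value of `starProduct`. -/
theorem map_braidInvAmp (hc : IsRegularBraiding Fib) (hWreg : BraidedMU.IsRegular Fib W) :
    Fib.map (L.braidInvAmp F) = Fib.amp (L.braidInvComp F Fib) K := by
  have h : ∃ Z, IsStarProduct Fib L.U L.V Z :=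
    exists_isStarProduct hc hWreg L.unitary_U L.unitary_V L.corep L.rep
  have hZ : IsStarProduct Fib L.U L.V (starProduct Fib L.U L.V) := by
    rw [starProduct, dif_pos h]
    exact h.choose_spec
  rw [braidInvComp, braidingInv, braiding, adjoint_comp, adjoint_adjoint, ← Fib.map_adj,
    adj_eq_inv_of_isUnitary (hc.1 L.X L.X), braidInvAmp, Fib.map_comp, Fib.map_comp, ← hZ.2,
    ← Fib.amp_map, ← Fib.amp_map, ← Fib.amp_comp, ← Fib.amp_comp]

theorem map_at234_braidInvAmp (hc : IsRegularBraiding Fib) (hWreg : BraidedMU.IsRegular Fib W) :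
    Fib.map (at234 K (L.braidInvAmp F)) = Fib.amp (Fib.map (α_ K L.X L.X).inv ∘L
      Fib.lamp K (L.braidInvComp F Fib) ∘L Fib.map (α_ K L.X L.X).hom) K := by
  rw [at234, Fib.map_comp, Fib.map_comp, Fib.map_at23, map_braidInvAmp L F hc hWreg,
    Fib.lamp_amp, ← Fib.amp_map, ← Fib.amp_map, ← Fib.amp_comp, ← Fib.amp_comp,
    ContinuousLinearMap.comp_assoc]

/-- The slices of `c⁻¹ (W ⋉ F)` are products of slices of the two factors `corner` and `Φ⁻¹ F`:
the regularity of the corepresentation `U` splits the factorization in between. -/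
theorem slices_semidirect (hc : IsRegularBraiding Fib) (hWreg : BraidedMU.IsRegular Fib W) :
    Fib.slices (Fib.map (L.semidirect F ≫ (β_ (K ⊗ L.X) (K ⊗ L.X)).inv)) =
      closedSpan (fun p : (Fib.obj K × Fib.obj K) × (Fib.obj L.X × Fib.obj L.X) =>
        Fib.bra (K ⊗ L.X) p.1.2 ∘L Fib.map L.corner ∘L Fib.ket (K ⊗ L.X) p.1.1 ∘L
          Fib.lamp K (Fib.bra L.X p.2.2 ∘L L.braidInvComp F Fib ∘L Fib.ket L.X p.2.1)) := by
  have hinv : ((β_ L.X K).hom ≫ CStarCategory.adj L.V) ≫ L.V ≫ (β_ L.X K).inv = 𝟙 _ := by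
    simp only [Category.assoc]
    rw [reassoc_of% L.unitary_V.2, Iso.hom_inv_id]
  have hinv' : (L.V ≫ (β_ L.X K).inv) ≫ (β_ L.X K).hom ≫ CStarCategory.adj L.V = 𝟙 _ := by
    simp only [Category.assoc, Iso.inv_hom_id_assoc, L.unitary_V.1]
  set P := L.braidInvComp F Fib with hP
  set g := (β_ L.X K).hom ≫ CStarCategory.adj L.V with hg
  have htot : closedSpan (fun p : Fib.obj L.X × Fib.obj K =>
      Fib.map g (Fib.μ L.X K (p.1 ⊗ₜ[ℂ] p.2))) = ⊤ :=
    closedSpan_map_of_surjective (Fib.closedSpan_tmul L.X K) (Fib.map g)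
      (Fib.map_surjective_of_comp_eq_id hinv')
  have e1 (x : Fib.obj L.X) (k η : Fib.obj K) (l : Fib.obj L.X) :
      Fib.bra (K ⊗ L.X) (Fib.μ K L.X (η ⊗ₜ[ℂ] l)) ∘L
        Fib.map (L.semidirect F ≫ (β_ (K ⊗ L.X) (K ⊗ L.X)).inv) ∘L
          Fib.ket (K ⊗ L.X) (Fib.map g (Fib.μ L.X K (x ⊗ₜ[ℂ] k))) =
      Fib.bra (K ⊗ L.X) η ∘L Fib.map L.corner ∘L
        Fib.lamp (K ⊗ L.X) (Fib.bra K l ∘L Fib.map (L.U ≫ (β_ K L.X).inv) ∘L Fib.ket L.X k) ∘L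
          (Fib.map (α_ K L.X L.X).inv ∘L Fib.lamp K P ∘L Fib.map (α_ K L.X L.X).hom) ∘L
            Fib.ket (K ⊗ L.X) x := by
    ext v
    simp only [ContinuousLinearMap.comp_apply]
    rw [semidirect_braid_inv, Fib.map_comp_apply, Fib.map_whiskerLeft_ket_apply,
      ← Fib.map_comp_apply, hinv, Fib.map_id, ContinuousLinearMap.id_apply, Fib.map_comp_apply,
      Fib.map_assoc_inv_ket_apply, Fib.map_comp_apply, map_at234_braidInvAmp L F hc hWreg,
      Fib.amp_ket_apply, Fib.map_comp_apply, Fib.map_comp_apply, ← Fib.bra_bra_map_assoc_inv_apply,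
      Fib.map_hom_inv_apply, Fib.bra_map_whiskerRight_apply, Fib.bra_map_at23_ket_apply]
    rfl
  rw [Fib.slices_eq_closedSpan_of_total _ htot (Fib.closedSpan_tmul K L.X)]
  have ht := slices_corep hc hWreg L.unitary_U L.corep
  rw [Fib.slices_eq_closedSpan, FibreFunctor.compacts,
    compactOperator_eq_closedSpan_rankOne] at ht
  refine closedSpan_exchange ht
    (fun q : Fib.obj K × Fib.obj L.X => (compL ℂ _ _ _
      (Fib.bra (K ⊗ L.X) q.1 ∘L Fib.map L.corner)).comp (((compL ℂ _ _ _).flip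
        ((Fib.map (α_ K L.X L.X).inv ∘L Fib.lamp K P ∘L Fib.map (α_ K L.X L.X).hom) ∘L
          Fib.ket (K ⊗ L.X) q.2)).comp (Fib.lamp (K ⊗ L.X))))
    (fun p => ((p.2.1, p.1.1), (p.1.2, p.2.2))) (fun p => ((p.1.2, p.2.1), (p.1.1, p.2.2)))
    (fun p => ⟨((p.1.2, p.2.1), (p.1.1, p.2.2)), rfl⟩)
    (fun p => ⟨((p.2.1, p.1.1), (p.1.2, p.2.2)), rfl⟩)
    (fun p => e1 p.1.1 p.1.2 p.2.1 p.2.2) (fun p => ?_)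
  simp only [ContinuousLinearMap.comp_apply, compL_apply, flip_apply, Fib.lamp_rankOne,
    ContinuousLinearMap.comp_assoc]
  rw [← Fib.bra_lamp_ket]
  simp only [ContinuousLinearMap.comp_assoc]

/-! ### Regularity of the semi-direct product -/

theorem corner_ket_ket (k : Fib.obj K) (l : Fib.obj L.X) (v : Fib.obj K) :
    Fib.map L.corner (Fib.ket (K ⊗ L.X) k (Fib.ket K l v)) =
      Fib.map (at23 K (β_ L.X K).inv) (Fib.map ((W ≫ (β_ K K).inv) ▷ L.X)
        (Fib.map (α_ K K L.X).inv (Fib.ket K (Fib.map ((β_ L.X K).hom ≫ CStarCategory.adj L.V)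
          (Fib.μ L.X K (l ⊗ₜ[ℂ] k))) v))) := by
  rw [corner, Fib.map_comp_apply, Fib.map_comp_apply, Fib.map_at23_ket_ket_apply]

/-- If `F` is regular, then so is `W ⋉ F`: rank one operators on `L` absorb `V`, and what is left
are products of slices of `c⁻¹ W` and of a braiding. -/
theorem isRegular_semidirect (hc : IsRegularBraiding Fib) (hWreg : BraidedMU.IsRegular Fib W)
    (hF : L.IsRegular Fib F) : BraidedMU.IsRegular Fib (L.semidirect F) := by
  have hinv' : (L.V ≫ (β_ L.X K).inv) ≫ (β_ L.X K).hom ≫ CStarCategory.adj L.V = 𝟙 _ := by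
    simp only [Category.assoc, Iso.inv_hom_id_assoc, L.unitary_V.1]
  have hP : Fib.slices (L.braidInvComp F Fib) = Fib.compacts L.X L.X := hF
  rw [Fib.slices_eq_closedSpan, FibreFunctor.compacts,
    compactOperator_eq_closedSpan_rankOne] at hP
  have hβ := slices_braid_inv hc L.X K
  rw [Fib.slices_eq_closedSpan, FibreFunctor.compacts,
    compactOperator_eq_closedSpan_rankOne] at hβ
  set g := (β_ L.X K).hom ≫ CStarCategory.adj L.V with hg
  have htot : closedSpan (fun p : Fib.obj L.X × Fib.obj K =>
      Fib.map g (Fib.μ L.X K (p.1 ⊗ₜ[ℂ] p.2))) = ⊤ :=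
    closedSpan_map_of_surjective (Fib.closedSpan_tmul L.X K) (Fib.map g)
      (Fib.map_surjective_of_comp_eq_id hinv')
  rw [BraidedMU.IsRegular, slices_semidirect L F hc hWreg]
  -- Replace the slices of `Φ⁻¹ F` by rank one operators `|a⟩⟨b|`.
  have step1 := closedSpan_exchange hP
    (fun q : Fib.obj K × Fib.obj K => (compL ℂ _ _ _ (Fib.bra (K ⊗ L.X) q.2 ∘L
      Fib.map L.corner ∘L Fib.ket (K ⊗ L.X) q.1)).comp (Fib.lamp K))
    (g := fun p : (Fib.obj K × Fib.obj K) × (Fib.obj L.X × Fib.obj L.X) =>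
      Fib.bra (K ⊗ L.X) p.1.2 ∘L Fib.map L.corner ∘L Fib.ket (K ⊗ L.X) p.1.1 ∘L
        Fib.lamp K (Fib.bra L.X p.2.2 ∘L L.braidInvComp F Fib ∘L Fib.ket L.X p.2.1))
    (g' := fun p : (Fib.obj K × Fib.obj L.X) × (Fib.obj L.X × Fib.obj K) =>
      ((compL ℂ _ _ _).flip (Fib.bra K p.1.2)) ((compL ℂ _ _ _ (Fib.bra (K ⊗ L.X) p.1.1 ∘L
        Fib.map (at23 K (β_ L.X K).inv) ∘L Fib.map ((W ≫ (β_ K K).inv) ▷ L.X) ∘L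
        Fib.map (α_ K K L.X).inv)) (Fib.ketL K (K ⊗ L.X)
          (Fib.map g (Fib.μ L.X K (p.2.1 ⊗ₜ[ℂ] p.2.2))))))
    id (fun p => ((p.2.2, p.1.1), (p.2.1, p.1.2))) Function.surjective_id
    (fun p => ⟨((p.1.2, p.2.2), (p.2.1, p.1.1)), rfl⟩) (fun p => rfl) (fun p => by
      ext v
      simp only [ContinuousLinearMap.comp_apply, compL_apply, flip_apply, Fib.lamp_rankOne,
        Fib.ketL_apply, corner_ket_ket, hg])
  -- Replace the vectors `V* c (a ⊗ k)` by product vectors.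
  have step2 := closedSpan_exchange (htot.trans (Fib.closedSpan_tmul K L.X).symm)
    (fun q : Fib.obj K × Fib.obj L.X => ((compL ℂ _ _ _).flip (Fib.bra K q.2)).comp
      ((compL ℂ _ _ _ (Fib.bra (K ⊗ L.X) q.1 ∘L
        Fib.map (at23 K (β_ L.X K).inv) ∘L Fib.map ((W ≫ (β_ K K).inv) ▷ L.X) ∘L
        Fib.map (α_ K K L.X).inv)).comp (Fib.ketL K (K ⊗ L.X))))
    (g := fun p : (Fib.obj K × Fib.obj L.X) × (Fib.obj L.X × Fib.obj K) =>
      ((compL ℂ _ _ _).flip (Fib.bra K p.1.2)) ((compL ℂ _ _ _ (Fib.bra (K ⊗ L.X) p.1.1 ∘L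
        Fib.map (at23 K (β_ L.X K).inv) ∘L Fib.map ((W ≫ (β_ K K).inv) ▷ L.X) ∘L
        Fib.map (α_ K K L.X).inv)) (Fib.ketL K (K ⊗ L.X)
          (Fib.map g (Fib.μ L.X K (p.2.1 ⊗ₜ[ℂ] p.2.2))))))
    (g' := fun p : (Fib.obj K × Fib.obj L.X) × (Fib.obj L.X × Fib.obj K) =>
      Fib.lamp K (Fib.bra L.X p.2.2 ∘L Fib.map (β_ L.X K).inv ∘L Fib.ket K p.2.1) ∘L
        Fib.map (W ≫ (β_ K K).inv) ∘L Fib.ket K p.1.1 ∘L Fib.bra K p.1.2)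
    id (fun p => ((p.2.2, p.1.2), (p.1.1, p.2.1))) Function.surjective_id
    (fun p => ⟨((p.2.1, p.1.2), (p.2.2, p.1.1)), rfl⟩) (fun p => rfl) (fun p => by
      ext v
      simp only [ContinuousLinearMap.comp_apply, compL_apply, flip_apply, Fib.ketL_apply]
      rw [Fib.map_assoc_inv_ket_apply, Fib.map_whiskerRight_ket_apply,
        Fib.bra_map_at23_ket_apply])
  -- Replace the slices of the braiding, then those of `c⁻¹ W`, by rank one operators.
  have step3 := closedSpan_exchange hβ
    (fun q : Fib.obj K × Fib.obj L.X => ((compL ℂ _ _ _).flip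
      (Fib.map (W ≫ (β_ K K).inv) ∘L Fib.ket K q.1 ∘L Fib.bra K q.2)).comp (Fib.lamp K))
    (g := fun p : (Fib.obj K × Fib.obj L.X) × (Fib.obj L.X × Fib.obj K) =>
      Fib.lamp K (Fib.bra L.X p.2.2 ∘L Fib.map (β_ L.X K).inv ∘L Fib.ket K p.2.1) ∘L
        Fib.map (W ≫ (β_ K K).inv) ∘L Fib.ket K p.1.1 ∘L Fib.bra K p.1.2)
    (g' := fun p : (Fib.obj L.X × Fib.obj L.X) × (Fib.obj K × Fib.obj K) =>
      Fib.ket K p.1.1 ∘L (Fib.bra K p.2.2 ∘L Fib.map (W ≫ (β_ K K).inv) ∘L Fib.ket K p.2.1) ∘L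
        Fib.bra K p.1.2)
    id (fun p => ((p.2.1, p.1.2), (p.1.1, p.2.2))) Function.surjective_id
    (fun p => ⟨((p.2.1, p.1.2), (p.1.1, p.2.2)), rfl⟩) (fun p => rfl) (fun p => by
      simp only [ContinuousLinearMap.comp_apply, compL_apply, flip_apply, Fib.lamp_rankOne,
        ContinuousLinearMap.comp_assoc])
  have step4 := closedSpan_exchange hWreg.closedSpan_slices
    (fun q : Fib.obj L.X × Fib.obj L.X => (compL ℂ _ _ _ (Fib.ket K q.1)).comp
      ((compL ℂ _ _ _).flip (Fib.bra K q.2)))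
    (g := fun p : (Fib.obj L.X × Fib.obj L.X) × (Fib.obj K × Fib.obj K) =>
      Fib.ket K p.1.1 ∘L (Fib.bra K p.2.2 ∘L Fib.map (W ≫ (β_ K K).inv) ∘L Fib.ket K p.2.1) ∘L
        Fib.bra K p.1.2)
    (g' := fun p : (Fib.obj K × Fib.obj L.X) × (Fib.obj K × Fib.obj L.X) =>
      rankOne ℂ (Fib.μ K L.X (p.1.1 ⊗ₜ[ℂ] p.1.2)) (Fib.μ K L.X (p.2.1 ⊗ₜ[ℂ] p.2.2)))
    id (fun p => ((p.1.2, p.2.2), (p.1.1, p.2.1))) Function.surjective_id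
    (fun p => ⟨((p.2.1, p.1.1), (p.2.2, p.1.2)), rfl⟩) (fun p => rfl) (fun p => by
      simp only [ContinuousLinearMap.comp_apply, compL_apply, flip_apply, rankOne_comp,
        comp_rankOne, FibreFunctor.bra, adjoint_adjoint]
      rfl)
  rw [step1, step2, step3, step4, FibreFunctor.compacts]
  exact (compactOperator_eq_closedSpan_rankOne_of_total (Fib.closedSpan_tmul K L.X)
    (Fib.closedSpan_tmul K L.X)).symm

/-! ### Fixed vectors and the converse -/

/-- The braiding with the unit object is trivial, so a morphism from the unit object gives a vector
that passes through the braiding as through the flip. -/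
theorem map_braid_inv_vec (e : 𝟙_ C ⟶ K) (X : C) (x : Fib.obj X) :
    Fib.map (β_ X K).inv (Fib.μ K X (vec Fib e ⊗ₜ[ℂ] x)) = Fib.μ X K (x ⊗ₜ[ℂ] vec Fib e) := by
  have h := BraidedCategory.braiding_inv_naturality_left e X
  rw [braiding_inv_tensorUnit_right, Category.assoc] at h
  have hρ : Fib.map (ρ_ X).inv x = Fib.μ X (𝟙_ C) (x ⊗ₜ[ℂ] Fib.ε 1) := by
    conv_lhs => rw [← Fib.μ_rightUnit X x]
    exact Fib.map_hom_inv_apply _ _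
  rw [vec, ← Fib.μ_natural_left, ← Fib.map_comp_apply, h, Fib.map_comp_apply, Fib.map_comp_apply,
    Fib.μ_leftUnit, hρ, Fib.μ_natural_right]

/-- A fixed vector on the last leg is brought to the front, since `c⁻¹ W (e ⊗ ξ) = ξ ⊗ e`; only the
unitary `V* c` remains. -/
theorem corner_fixedVector {e : 𝟙_ C ⟶ K} (he : IsFixedVector Fib W e) (k : Fib.obj K)
    (l : Fib.obj L.X) :
    Fib.map L.corner (Fib.ket (K ⊗ L.X) k (Fib.ket K l (vec Fib e))) =
      Fib.ket (K ⊗ L.X) (vec Fib e)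
        (Fib.map ((β_ L.X K).hom ≫ CStarCategory.adj L.V) (Fib.μ L.X K (l ⊗ₜ[ℂ] k))) := by
  have h : Fib.map (at23 K (β_ L.X K).inv) ∘L Fib.map ((W ≫ (β_ K K).inv) ▷ L.X) ∘L
      Fib.map (α_ K K L.X).inv ∘L (Fib.ketL K (K ⊗ L.X)).flip (vec Fib e) =
      Fib.ket (K ⊗ L.X) (vec Fib e) := by
    refine FibreFunctor.hom_ext fun k' l' => ?_
    simp only [ContinuousLinearMap.comp_apply, flip_apply, Fib.ketL_apply]
    rw [Fib.map_assoc_inv_ket_apply, Fib.map_whiskerRight_ket_apply, Fib.map_comp_apply,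
      Fib.ket_apply K k', he, map_braid_inv_vec, ← Fib.ket_apply, Fib.map_at23_ket_ket_apply,
      map_braid_inv_vec, Fib.map_assoc_inv_ket_apply]
    rfl
  rw [corner_ket_ket]
  exact DFunLike.congr_fun h _

/-- If `W` has a non-zero fixed vector `e`, then `F` is regular when `W ⋉ F` is: compressing the
slices of `c⁻¹ (W ⋉ F)` by `e` yields the slices of `Φ⁻¹ F`. -/
theorem isRegular_of_semidirect (hc : IsRegularBraiding Fib) (hWreg : BraidedMU.IsRegular Fib W)
    {e : 𝟙_ C ⟶ K} (he : IsFixedVector Fib W e) (he0 : vec Fib e ≠ 0)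
    (h : BraidedMU.IsRegular Fib (L.semidirect F)) : L.IsRegular Fib F := by
  rw [BraidedMU.IsRegular, slices_semidirect L F hc hWreg] at h
  set ε := vec Fib e with hε
  have hε0 : ⟪ε, ε⟫_ℂ ≠ 0 := inner_self_ne_zero.2 he0
  set g := (β_ L.X K).hom ≫ CStarCategory.adj L.V with hg
  set g' := L.V ≫ (β_ L.X K).inv with hg'
  have hinv : g ≫ g' = 𝟙 _ := by
    rw [hg, hg']
    simp only [Category.assoc]
    rw [reassoc_of% L.unitary_V.2, Iso.hom_inv_id]
  have hgg' (y : Fib.obj (L.X ⊗ K)) : Fib.map g' (Fib.map g y) = y := by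
    rw [← Fib.map_comp_apply, hinv, Fib.map_id, ContinuousLinearMap.id_apply]
  let G (p : (Fib.obj K × Fib.obj K) × (Fib.obj L.X × Fib.obj L.X)) :=
    Fib.bra (K ⊗ L.X) p.1.2 ∘L Fib.map L.corner ∘L Fib.ket (K ⊗ L.X) p.1.1 ∘L
      Fib.lamp K (Fib.bra L.X p.2.2 ∘L L.braidInvComp F Fib ∘L Fib.ket L.X p.2.1)
  -- The compression `T ↦ (id ⊗ ⟨e|) c⁻¹ V T (|e⟩ ⊗ id)`.
  let left : Fib.obj (K ⊗ L.X) →L[ℂ] Fib.obj L.X := Fib.bra L.X ε ∘L Fib.map g'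
  let right : Fib.obj L.X →L[ℂ] Fib.obj (K ⊗ L.X) := (Fib.ketL K L.X).flip ε
  let Ψ := (compL ℂ (Fib.obj L.X) _ _ left).comp ((compL ℂ _ (Fib.obj (K ⊗ L.X)) _).flip right)
  have hΨ (T : Fib.obj (K ⊗ L.X) →L[ℂ] Fib.obj (K ⊗ L.X)) (x : Fib.obj L.X) :
      Ψ T x = Fib.bra L.X ε (Fib.map g' (T (Fib.ket K x ε))) := rfl
  have hΨG (p) : Ψ (G p) = (⟪p.1.2, ε⟫_ℂ * ⟪ε, p.1.1⟫_ℂ) •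
      (Fib.bra L.X p.2.2 ∘L L.braidInvComp F Fib ∘L Fib.ket L.X p.2.1) := by
    ext x
    rw [hΨ]
    simp only [G, ContinuousLinearMap.comp_apply, smul_apply]
    rw [Fib.lamp_ket_apply, corner_fixedVector L he, Fib.ket_apply (K ⊗ L.X), Fib.bra_tmul,
      map_smul, map_smul, hgg', Fib.bra_tmul, smul_smul]
    rfl
  change Fib.slices (L.braidInvComp F Fib) = Fib.compacts L.X L.X
  rw [Fib.slices_eq_closedSpan]
  refine le_antisymm (closedSpan_le isClosed_compactOperator fun p => ?_) ?_
  · have hG : G ((ε, ε), p) ∈ Fib.compacts (K ⊗ L.X) (K ⊗ L.X) :=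
      h ▸ mem_closedSpan G ((ε, ε), p)
    have hG' : IsCompactOperator (G ((ε, ε), p)) := hG
    have hcomp : Ψ (G ((ε, ε), p)) ∈ Fib.compacts L.X L.X :=
      (hG'.comp_clm right).clm_comp left
    rw [hΨG] at hcomp
    exact (Submodule.smul_mem_iff _ (mul_ne_zero hε0 hε0)).1 hcomp
  · rw [FibreFunctor.compacts, compactOperator_eq_closedSpan_rankOne]
    refine closedSpan_le (isClosed_closedSpan _) fun p => ?_
    have hmem : rankOne ℂ (Fib.map g (Fib.μ L.X K (p.1 ⊗ₜ[ℂ] ε))) (Fib.μ K L.X (ε ⊗ₜ[ℂ] p.2)) ∈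
        closedSpan G := by
      refine h ▸ ?_
      exact rankOne_mem_compactOperator _ _
    have hΨmem := map_mem_of_mem_closedSpan Ψ (isClosed_closedSpan
      (fun p : Fib.obj L.X × Fib.obj L.X =>
        Fib.bra L.X p.2 ∘L L.braidInvComp F Fib ∘L Fib.ket L.X p.1)) (fun p => by
      rw [hΨG]
      exact Submodule.smul_mem _ _ (mem_closedSpan (fun p : Fib.obj L.X × Fib.obj L.X =>
        Fib.bra L.X p.2 ∘L L.braidInvComp F Fib ∘L Fib.ket L.X p.1) p.2)) hmem
    have hval : Ψ (rankOne ℂ (Fib.map g (Fib.μ L.X K (p.1 ⊗ₜ[ℂ] ε)))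
        (Fib.μ K L.X (ε ⊗ₜ[ℂ] p.2))) = (⟪ε, ε⟫_ℂ * ⟪ε, ε⟫_ℂ) • rankOne ℂ p.1 p.2 := by
      ext x
      rw [hΨ, rankOne_apply, map_smul, map_smul, hgg', Fib.bra_tmul, Fib.ket_apply,
        LinearIsometry.inner_map_map, TensorProduct.inner_tmul, smul_apply, rankOne_apply,
        smul_smul, smul_smul]
      ring_nf
    rw [hval] at hΨmem
    exact (Submodule.smul_mem_iff _ (mul_ne_zero hε0 hε0)).1 hΨmem

end YetterDrinfeld

end

end BraidedMU

theorem mainTheorem6 {C : Type u} [Category.{v} C] [Preadditive C] [Linear ℂ C]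
    [MonoidalCategory C] [MonoidalPreadditive C] [MonoidalLinear ℂ C]
    [BraidedMU.MonoidalWStarCategory C] [BraidedCategory C]
    (Fib : BraidedMU.FibreFunctor.{v, u, w} C)
    (hc : BraidedMU.IsRegularBraiding Fib)
    {K : C} (W : K ⊗ K ⟶ K ⊗ K)
    (hW : BraidedMU.IsMultiplicativeUnitary W) (hWreg : BraidedMU.IsRegular Fib W)
    (L : BraidedMU.YetterDrinfeld W) (F : L.X ⊗ L.X ⟶ L.X ⊗ L.X)
    (hF : BraidedMU.YetterDrinfeld.IsMultiplicativeUnitary Fib L F) :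
    (BraidedMU.YetterDrinfeld.IsRegular Fib L F →
      BraidedMU.IsRegular Fib (L.semidirect F)) ∧
    ((∃ e : 𝟙_ C ⟶ K, BraidedMU.IsFixedVector Fib W e ∧ BraidedMU.vec Fib e ≠ 0) →
      BraidedMU.IsRegular Fib (L.semidirect F) →
      BraidedMU.YetterDrinfeld.IsRegular Fib L F) := by
  exact ⟨L.isRegular_semidirect F hc hWreg,
    fun ⟨_, he, he0⟩ h => L.isRegular_of_semidirect F hc hWreg he he0 h⟩
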